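/- Let $k$ be a commutative ring. For $n\ge 1$ let $\mathcal T(n)$ be the set of shuffle binary trees of arity $n$: planar binary rooted trees whose leaves are labelled bijectively by $1,\dots,n$ and such that at every internal vertex the smallest leaf label above the left input is smaller than the smallest leaf label above the right input. The spaces $k\langle\mathcal T(n)\rangle$ form the free operad on one commutative binary generator $\mu$, viewed as a shuffle operad, with shuffle compositions $\circ_{i,w}$; and $\operatorname{Com}=\mathcal T(\mu)/(R)$, where $(R)$ is the ideal generated by $1(23)-(12)3$ and $1(23)-(13)2$. Let $\Pi_n$ be the poset of partitions of $\{1,\dots,n\}$ ordered by refinement, with bottom $\hat 0$ (singletons) and top $\hat 1$ (one part). The Björner–Gessel labelling labels the edge $x\prec y$ that merges two parts $A,B$ of $x$ by $\max(\min A,\min B)$. A maximal chain $c$ of $\Pi_n$ has an underlying tree $\pi(c)\in\mathcal T(n)$: start with the leaf $i$ on each part $\{i\}$, and each time two parts with minima $a<b$ are merged, graft their trees as left and right inputs of a new vertex; $\pi(c)$ is the tree on the last part. For $a\ne b$ in $\mathcal T(n)$ write $a\lessdot b$ if there are maximal chains $\tilde a=r\cdot(g\prec x\prec h)\cdot s$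 and $\tilde b=r\cdot(g\prec y\prec h)\cdot s$ with $\pi(\tilde a)=a$, $\pi(\tilde b)=b$, such that $g\prec x\prec h$ is the unique maximal chain of $[g,h]$ with strictly increasing labels and its labels lexicographically precede those of every other maximal chain of $[g,h]$. Let $\le$ be the reflexive and transitive closure of $\lessdot$, and let $\mathcal B(n)\subset\mathcal T(n)$ be the set of $\le$-minimal trees. Then: 1. For every $n\ge 1$ the labelling is an EL-labelling of $\Pi_n$ (a CL-labelling in which the label of an edge does not depend on the chain): every interval $[x,y]$ has a unique maximal chain with strictly increasing labels, and its tuple of labels lexicographically precedes that of every other maximal chain of $[x,y]$. 2. $\mathcal B=(\mathcal B(n))_n$ is a PBW basis of $\operatorname{Com}$ over $k$ with respect to $\le$. That is: $\le$ is a partial order on each $\mathcal T(n)$, compatible with shuffle composition ($\alpha\le\alpha'$ and $\beta\le\beta'$ imply $\alpha\circ_{i,w}\beta\le\alpha'\circ_{i,w}\beta'$); $\mathcal B$ contains the unit and $\mu$; the classes of the elements of $\mathcal B(n)$ form a $k$-basis of $\operatorname{Com}(n)$; for $\alpha,\beta\in\mathcal B$ and every pointed shuffle $w$, either $\alpha\circ_{i,w}\beta\in\mathcal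 B$, or $\alpha\circ_{i,w}\beta$ is equal in $\operatorname{Com}$ to a linear combination of elements $\gamma\in\mathcal B$ with $\gamma<\alpha\circ_{i,w}\beta$; and a tree is in $\mathcal B$ if and only if for each of its internal edges the two-vertex tree obtained by restriction to that edge (its three inputs relabelled $1,2,3$ in the order of their smallest leaves) is in $\mathcal B$. 3. A tree $a\in\mathcal T(n)$ is in $\mathcal B(n)$ if and only if $a=\pi(c)$ for a maximal chain $c$ of $\Pi_n$ which is the unique maximal chain with strictly increasing labels (and whose labels are lexicographically first). 4. $\mathcal B$ is the set of binary left combs with leaves labelled $1,\dots,n$ from left to right: for every $n\ge1$, $\mathcal B(n)=\{((\cdots((1\,2)\,3)\cdots)\,n)\}$. -/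

import Mathlib

/-! ## Saturated chains and EL-labellings of posets -/

/-- `c` is a maximal chain `x = x₀ ⋖ x₁ ⋖ ⋯ ⋖ x_m = y` of the interval `[x, y]`. -/
def IsMaxChainOf {α : Type*} [PartialOrder α] (x y : α) (c : List α) : Prop :=
  c.IsChain (· ⋖ ·) ∧ c.head? = some x ∧ c.getLast? = some y

/-- The tuple of labels read along a chain, from bottom to top. -/
def chainLabels {α Λ : Type*} (lab : α → α → Λ) : List α → List Λ
  | [] => []
  | [_] => []
  | x :: y :: l => lab x y :: chainLabels lab (y :: l)

/-- The labels of the chain are strictly increasing. -/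
def IsIncreasing {α Λ : Type*} [Preorder Λ] (lab : α → α → Λ) (c : List α) : Prop :=
  (chainLabels lab c).IsChain (· < ·)

/-- `c` is the unique maximal chain of `[x, y]` with strictly increasing labels, and its tuple of
labels lexicographically precedes that of every other maximal chain of `[x, y]`. -/
structure IsMinIncreasingChain {α Λ : Type*} [PartialOrder α] [PartialOrder Λ]
    (lab : α → α → Λ) (x y : α) (c : List α) : Prop where
  isMaxChain : IsMaxChainOf x y c
  isIncreasing : IsIncreasing lab c
  unique : ∀ c' : List α, IsMaxChainOf x y c' → IsIncreasing lab c' → c' = c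
  lex : ∀ c' : List α, IsMaxChainOf x y c' → c' ≠ c →
    List.Lex (· < ·) (chainLabels lab c) (chainLabels lab c')

/-- An EL-labelling: a CL-labelling in which the label of an edge `x ⋖ y` depends only on the
edge, and not on the maximal chain in which it is considered. -/
def IsELLabelling {α Λ : Type*} [PartialOrder α] [PartialOrder Λ] (lab : α → α → Λ) : Prop :=
  ∀ x y : α, x ≤ y → ∃ c : List α, IsMinIncreasingChain lab x y c

/-! ## Shuffle trees: the free operad on one commutative binary generator -/

/-- Planar binary trees with leaves labelled by natural numbers; every internal vertex carries the
binary generator `μ`. -/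
inductive BTree : Type
  | leaf (i : ℕ) : BTree
  | node (l r : BTree) : BTree

namespace BTree

/-- The labels of the leaves, from left to right. -/
def leaves : BTree → List ℕ
  | leaf i => [i]
  | node l r => l.leaves ++ r.leaves

/-- The smallest label of a leaf. -/
def minLeaf : BTree → ℕ
  | leaf i => i
  | node l r => min l.minLeaf r.minLeaf

/-- Above each vertex the inputs increase from left to right, where an input is measured by the
smallest label of the leaves above it. -/
def IsShuffle : BTree → Prop
  | leaf _ => True
  | node l r => l.minLeaf < r.minLeaf ∧ l.IsShuffle ∧ r.IsShuffle

/-- Replace every leaf `a` by the tree `σ a`. -/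
def bind (σ : ℕ → BTree) : BTree → BTree
  | leaf i => σ i
  | node l r => node (l.bind σ) (r.bind σ)

/-- Relabel the leaves. -/
def map (φ : ℕ → ℕ) (t : BTree) : BTree := t.bind fun a => leaf (φ a)

/-- The order-preserving relabelling of the leaves by `1, …, n`. -/
def standardize (t : BTree) : BTree :=
  t.map fun a => (t.leaves.toFinset.filter (· ≤ a)).card

/-- `EdgeRestriction t s`: for some internal edge `e` of `t`, the tree `s` is the restriction of
`t` to `e`, that is, the two vertices joined by `e` together with their three remaining inputs,
each input being replaced by a leaf (ordered by the smallest leaf above it, labels `1, 2, 3`). -/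
inductive EdgeRestriction : BTree → BTree → Prop
  | left (a b c : BTree) : EdgeRestriction (node (node a b) c)
      (standardize (node (node (leaf a.minLeaf) (leaf b.minLeaf)) (leaf c.minLeaf)))
  | right (a b c : BTree) : EdgeRestriction (node a (node b c))
      (standardize (node (leaf a.minLeaf) (node (leaf b.minLeaf) (leaf c.minLeaf))))
  | inLeft {l s : BTree} (r : BTree) : EdgeRestriction l s → EdgeRestriction (node l r) s
  | inRight {r s : BTree} (l : BTree) : EdgeRestriction r s → EdgeRestriction (node l r) s

/-- The left comb `((⋯((1 2) 3)⋯) n)`, with leaves labelled `1, …, n` from left to right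
(used for `n ≥ 1`). -/
def leftComb : ℕ → BTree
  | 0 => leaf 1
  | 1 => leaf 1
  | n + 2 => node (leftComb (n + 1)) (leaf (n + 2))

theorem leaves_bind (σ : ℕ → BTree) (t : BTree) :
    (t.bind σ).leaves = t.leaves.flatMap fun a => (σ a).leaves := by
  induction t with
  | leaf i => simp [bind, leaves]
  | node l r hl hr => simp [bind, leaves, hl, hr]

theorem minLeaf_mem (t : BTree) : t.minLeaf ∈ t.leaves := by
  induction t with
  | leaf i => simp [minLeaf, leaves]
  | node l r hl hr =>
    rcases le_total l.minLeaf r.minLeaf with h | h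
    · simp [minLeaf, leaves, h, hl]
    · simp [minLeaf, leaves, h, hr]

theorem minLeaf_le (t : BTree) {a : ℕ} (ha : a ∈ t.leaves) : t.minLeaf ≤ a := by
  induction t with
  | leaf i => simp [leaves] at ha; simp [minLeaf, ha]
  | node l r hl hr =>
    simp only [leaves, List.mem_append] at ha
    rcases ha with h | h
    · exact (min_le_left _ _).trans (hl h)
    · exact (min_le_right _ _).trans (hr h)

theorem minLeaf_bind {σ : ℕ → BTree} {f : ℕ → ℕ} {S : Set ℕ} (hf : StrictMonoOn f S)
    (hσ : ∀ a ∈ S, (σ a).minLeaf = f a) (t : BTree) (ht : ∀ a ∈ t.leaves, a ∈ S) :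
    (t.bind σ).minLeaf = f t.minLeaf := by
  induction t with
  | leaf i => exact hσ i (ht i (by simp [leaves]))
  | node l r hl hr =>
    have h1 : ∀ a ∈ l.leaves, a ∈ S := fun a ha => ht a (by simp [leaves, ha])
    have h2 : ∀ a ∈ r.leaves, a ∈ S := fun a ha => ht a (by simp [leaves, ha])
    simp only [bind, minLeaf, hl h1, hr h2]
    have h3 := h1 _ l.minLeaf_mem
    have h4 := h2 _ r.minLeaf_mem
    rcases le_total l.minLeaf r.minLeaf with h | h
    · rw [min_eq_left h, min_eq_left ((hf.le_iff_le h3 h4).2 h)]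
    · rw [min_eq_right h, min_eq_right ((hf.le_iff_le h4 h3).2 h)]

theorem isShuffle_bind {σ : ℕ → BTree} {f : ℕ → ℕ} {S : Set ℕ} (hf : StrictMonoOn f S)
    (hσ : ∀ a ∈ S, (σ a).minLeaf = f a) (hs : ∀ a ∈ S, (σ a).IsShuffle) (t : BTree)
    (ht : ∀ a ∈ t.leaves, a ∈ S) (h : t.IsShuffle) : (t.bind σ).IsShuffle := by
  induction t with
  | leaf i => exact hs i (ht i (by simp [leaves]))
  | node l r hl hr =>
    have h1 : ∀ a ∈ l.leaves, a ∈ S := fun a ha => ht a (by simp [leaves, ha])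
    have h2 : ∀ a ∈ r.leaves, a ∈ S := fun a ha => ht a (by simp [leaves, ha])
    refine ⟨?_, hl h1 h.2.1, hr h2 h.2.2⟩
    rw [minLeaf_bind hf hσ l h1, minLeaf_bind hf hσ r h2]
    exact hf (h1 _ l.minLeaf_mem) (h2 _ r.minLeaf_mem) h.1

end BTree

/-- The shuffle trees with leaves labelled by `1, …, n` (each label once): the monomial basis of
the arity `n` component of the free operad on a commutative binary generator `μ`. -/
def ShTree (n : ℕ) : Type :=
  {t : BTree // t.IsShuffle ∧ t.leaves.Perm (List.range' 1 n)}

theorem ShTree.mem_leaves {n : ℕ} (t : ShTree n) (a : ℕ) :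
    a ∈ t.1.leaves ↔ a ∈ Set.Icc 1 n := by
  rw [t.2.2.mem_iff, List.mem_range'_1, Set.mem_Icc]; omega

/-- A pointed shuffle for the composition of an operation of arity `n` in the `i`-th entry of an
operation of arity `m`: `f` and `g` give the order-preserving placements in `{1, …, p}` of the
entries of the first and of the second operation, entry `i` of the first being placed at the first
entry of the second; all other entries have distinct places, and together they fill `{1, …, p}`. -/
structure PointedShuffle (m n p : ℕ) where
  i : ℕ
  f : ℕ → ℕ
  g : ℕ → ℕ
  i_mem : i ∈ Set.Icc 1 m
  f_strictMono : StrictMonoOn f (Set.Icc 1 m)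
  g_strictMono : StrictMonoOn g (Set.Icc 1 n)
  pointed : g 1 = f i
  disjoint : Disjoint (f '' (Set.Icc 1 m \ {i})) (g '' Set.Icc 1 n)
  cover : f '' (Set.Icc 1 m \ {i}) ∪ g '' Set.Icc 1 n = Set.Icc 1 p

namespace ShTree

/-- The tree placed at the leaf `a` of the first tree in a shuffle composition. -/
def graftAt {m n p : ℕ} (w : PointedShuffle m n p) (β : BTree) (a : ℕ) : BTree :=
  if a = w.i then β.map w.g else .leaf (w.f a)

theorem leaves_graftAt {m n p : ℕ} (w : PointedShuffle m n p) (β : BTree) (a : ℕ) :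
    (graftAt w β a).leaves = if a = w.i then β.leaves.map w.g else [w.f a] := by
  unfold graftAt
  split_ifs
  · rw [BTree.map, BTree.leaves_bind, List.map_eq_flatMap]
    rfl
  · rfl

theorem comp_mem {m n p : ℕ} (α : ShTree m) (β : ShTree n) (w : PointedShuffle m n p) :
    (α.1.bind (graftAt w β.1)).IsShuffle ∧
      (α.1.bind (graftAt w β.1)).leaves.Perm (List.range' 1 p) := by
  have hβ : ∀ a ∈ β.1.leaves, a ∈ Set.Icc 1 n := fun a => (β.mem_leaves a).1
  have hα : ∀ a ∈ α.1.leaves, a ∈ Set.Icc 1 m := fun a => (α.mem_leaves a).1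
  have hmin : β.1.minLeaf = 1 := by
    have h1 := hβ _ β.1.minLeaf_mem
    have h2 : 1 ∈ β.1.leaves := (β.mem_leaves 1).2 ⟨le_rfl, h1.1.trans h1.2⟩
    exact le_antisymm (β.1.minLeaf_le h2) h1.1
  have hσ : ∀ a ∈ Set.Icc 1 m, (graftAt w β.1 a).minLeaf = w.f a := by
    intro a _
    unfold graftAt
    split_ifs with h
    · rw [BTree.map, BTree.minLeaf_bind w.g_strictMono (fun _ _ => rfl) _ hβ, hmin, w.pointed, h]
    · rfl
  have hs : ∀ a ∈ Set.Icc 1 m, (graftAt w β.1 a).IsShuffle := by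
    intro a _
    unfold graftAt
    split_ifs with h
    · exact BTree.isShuffle_bind w.g_strictMono (fun _ _ => rfl)
        (fun _ _ => by simp [BTree.IsShuffle]) _ hβ β.2.1
    · trivial
  refine ⟨BTree.isShuffle_bind w.f_strictMono hσ hs _ hα α.2.1, ?_⟩
  have hαn : α.1.leaves.Nodup := α.2.2.nodup_iff.2 List.nodup_range'
  have hβn : β.1.leaves.Nodup := β.2.2.nodup_iff.2 List.nodup_range'
  rw [List.perm_ext_iff_of_nodup _ List.nodup_range']
  · intro x
    have hx : x ∈ List.range' 1 p ↔ x ∈ Set.Icc 1 p := by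
      rw [List.mem_range'_1, Set.mem_Icc]; omega
    rw [hx, ← w.cover, BTree.leaves_bind, List.mem_flatMap]
    simp only [leaves_graftAt]
    constructor
    · rintro ⟨a, ha, hxa⟩
      split_ifs at hxa with h
      · obtain ⟨b, hb, rfl⟩ := List.mem_map.1 hxa
        exact Or.inr ⟨b, hβ b hb, rfl⟩
      · rw [List.mem_singleton] at hxa
        exact Or.inl ⟨a, ⟨hα a ha, h⟩, hxa.symm⟩
    · rintro (⟨a, ⟨ha, hai⟩, rfl⟩ | ⟨b, hb, rfl⟩)
      · have hai' : a ≠ w.i := hai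
        exact ⟨a, (α.mem_leaves a).2 ha, by simp [hai']⟩
      · exact ⟨w.i, (α.mem_leaves _).2 w.i_mem, by
          simpa using ⟨b, (β.mem_leaves b).2 hb, rfl⟩⟩
  · rw [BTree.leaves_bind, List.nodup_flatMap]
    constructor
    · intro a _
      rw [leaves_graftAt]
      split_ifs
      · exact (List.nodup_map_iff_inj_on hβn).2
          fun x hx y hy h => w.g_strictMono.injOn (hβ x hx) (hβ y hy) h
      · exact List.nodup_singleton _
    · refine hαn.imp_of_mem ?_
      intro a b ha hb hab x hxa hxb
      simp only [leaves_graftAt] at hxa hxb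
      split_ifs at hxa hxb with h1 h2 h2
      · exact hab (h1.trans h2.symm)
      · obtain ⟨c, hc, rfl⟩ := List.mem_map.1 hxa
        exact Set.disjoint_left.1 w.disjoint
          ⟨b, ⟨hα b hb, h2⟩, (List.mem_singleton.1 hxb).symm⟩ ⟨c, hβ c hc, rfl⟩
      · obtain ⟨c, hc, rfl⟩ := List.mem_map.1 hxb
        exact Set.disjoint_left.1 w.disjoint
          ⟨a, ⟨hα a ha, h1⟩, (List.mem_singleton.1 hxa).symm⟩ ⟨c, hβ c hc, rfl⟩
      · exact hab (w.f_strictMono.injOn (hα a ha) (hα b hb)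
          ((List.mem_singleton.1 hxa).symm.trans (List.mem_singleton.1 hxb)))

/-- The shuffle composition `α ∘_{i,w} β`: relabel the trees according to `w` and graft the second
one on the `i`-th leaf of the first one. -/
def comp {m n p : ℕ} (w : PointedShuffle m n p) (α : ShTree m) (β : ShTree n) : ShTree p :=
  ⟨α.1.bind (graftAt w β.1), comp_mem α β w⟩

/-- The operadic unit. -/
def unit : ShTree 1 := ⟨.leaf 1, trivial, by decide⟩

/-- The generator `μ`. -/
def gen : ShTree 2 := ⟨.node (.leaf 1) (.leaf 2), by simp [BTree.IsShuffle, BTree.minLeaf],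
  by decide⟩

/-- `(1 2) 3`. -/
def tree12_3 : ShTree 3 := ⟨.node (.node (.leaf 1) (.leaf 2)) (.leaf 3),
  by simp [BTree.IsShuffle, BTree.minLeaf], by decide⟩

/-- `(1 3) 2`. -/
def tree13_2 : ShTree 3 := ⟨.node (.node (.leaf 1) (.leaf 3)) (.leaf 2),
  by simp [BTree.IsShuffle, BTree.minLeaf], by decide⟩

/-- `1 (2 3)`. -/
def tree1_23 : ShTree 3 := ⟨.node (.leaf 1) (.node (.leaf 2) (.leaf 3)),
  by simp [BTree.IsShuffle, BTree.minLeaf], by decide⟩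

end ShTree

/-! ## The linear operad `Com = 𝒯(μ)/(R)` and PBW bases -/

noncomputable section

/-- Membership in the ideal of the free shuffle operad `n ↦ k⟨ShTree n⟩` generated by `R`: the
smallest family of submodules that contains `R` and is stable under shuffle composition, on both
sides, with all trees (hence, by linearity, with all elements). -/
inductive MemShuffleIdeal {k : Type*} [CommRing k] (R : ∀ n, Set (ShTree n →₀ k)) :
    ∀ n, (ShTree n →₀ k) → Prop
  | rel {n : ℕ} {x : ShTree n →₀ k} : x ∈ R n → MemShuffleIdeal R n x
  | zero (n : ℕ) : MemShuffleIdeal R n 0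
  | add {n : ℕ} {x y : ShTree n →₀ k} :
      MemShuffleIdeal R n x → MemShuffleIdeal R n y → MemShuffleIdeal R n (x + y)
  | smul {n : ℕ} (c : k) {x : ShTree n →₀ k} :
      MemShuffleIdeal R n x → MemShuffleIdeal R n (c • x)
  | compRight {m n p : ℕ} (w : PointedShuffle m n p) (α : ShTree m) {x : ShTree n →₀ k} :
      MemShuffleIdeal R n x → MemShuffleIdeal R p (x.mapDomain fun β => ShTree.comp w α β)
  | compLeft {m n p : ℕ} (w : PointedShuffle m n p) (β : ShTree n) {x : ShTree m →₀ k} :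
      MemShuffleIdeal R m x → MemShuffleIdeal R p (x.mapDomain fun α => ShTree.comp w α β)

/-- The arity `n` component of the ideal generated by `R`. -/
def shuffleIdeal {k : Type*} [CommRing k] (R : ∀ n, Set (ShTree n →₀ k)) (n : ℕ) :
    Submodule k (ShTree n →₀ k) where
  carrier := {x | MemShuffleIdeal R n x}
  zero_mem' := .zero n
  add_mem' := .add
  smul_mem' c _ h := .smul c h

/-- The arity `n` component of the quotient operad `𝒯(μ)/(R)`. -/
abbrev QuotientOperad {k : Type*} [CommRing k] (R : ∀ n, Set (ShTree n →₀ k)) (n : ℕ) : Type _ :=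
  (ShTree n →₀ k) ⧸ shuffleIdeal R n

/-- The class of a tree in `𝒯(μ)/(R)`. -/
def treeClass {k : Type*} [CommRing k] (R : ∀ n, Set (ShTree n →₀ k)) {n : ℕ} (t : ShTree n) :
    QuotientOperad R n :=
  (shuffleIdeal R n).mkQ (Finsupp.single t 1)

/-- The relations of `Com` as a shuffle operad (associativity of the commutative product):
`1 (2 3) = (1 2) 3` and `1 (2 3) = (1 3) 2`. -/
def comRelations (k : Type*) [CommRing k] : ∀ n, Set (ShTree n →₀ k)
  | 3 => {Finsupp.single ShTree.tree1_23 1 - Finsupp.single ShTree.tree12_3 1,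
          Finsupp.single ShTree.tree1_23 1 - Finsupp.single ShTree.tree13_2 1}
  | _ => ∅

/-- `B` is a PBW basis of the operad `𝒯(μ)/(R)` over `k`, with respect to the order `le` on trees
(given arity by arity; `μ` is the only generator). -/
structure IsPBWBasis {k : Type*} [CommRing k] (R : ∀ n, Set (ShTree n →₀ k))
    (le : ∀ n, ShTree n → ShTree n → Prop) (B : ∀ n, Set (ShTree n)) : Prop where
  /-- `le` is a partial order on the trees -/
  le_refl : ∀ (n : ℕ) (a : ShTree n), le n a a
  le_trans : ∀ (n : ℕ) (a b c : ShTree n), le n a b → le n b c → le n a c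
  le_antisymm : ∀ (n : ℕ) (a b : ShTree n), le n a b → le n b a → a = b
  /-- which is compatible with the shuffle compositions. -/
  le_comp : ∀ (m n p : ℕ) (w : PointedShuffle m n p) (α α' : ShTree m) (β β' : ShTree n),
    le m α α' → le n β β' → le p (ShTree.comp w α β) (ShTree.comp w α' β')
  unit_mem : ShTree.unit ∈ B 1
  gen_mem : ShTree.gen ∈ B 2
  /-- The classes of the elements of `B` form a basis of the quotient. -/
  linearIndependent : ∀ n : ℕ, LinearIndependent k fun b : B n => treeClass R b.1
  span_eq_top : ∀ n : ℕ, Submodule.span k (Set.range fun b : B n => treeClass R b.1) = ⊤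
  /-- A composition of two elements of `B` is in `B`, or is equal in the quotient to a linear
  combination of strictly smaller elements of `B`. -/
  comp_mem_or : ∀ (m n p : ℕ) (w : PointedShuffle m n p), ∀ α ∈ B m, ∀ β ∈ B n,
    ShTree.comp w α β ∈ B p ∨
      ∃ c : ShTree p →₀ k,
        (∀ γ ∈ c.support, γ ∈ B p ∧ le p γ (ShTree.comp w α β) ∧ γ ≠ ShTree.comp w α β) ∧
        treeClass R (ShTree.comp w α β) = c.sum fun γ a => a • treeClass R γ
  /-- A tree is in `B` if and only if its restrictions to all internal edges are. -/
  mem_iff_edges : ∀ (n : ℕ) (α : ShTree n),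
    α ∈ B n ↔ ∀ s : BTree, BTree.EdgeRestriction α.1 s → ∃ s' ∈ B 3, s'.1 = s

/-! ## Partition posets, the Björner–Gessel labelling, and the trees of maximal chains -/

/-- The partition poset of `Com` in arity `n`: the partitions of `{1, …, n}` ordered by refinement,
from the partition into singletons `⊥` to the partition with one part `⊤`. -/
abbrev PartitionPoset (n : ℕ) : Type := Finpartition (Finset.Icc 1 n)

/-- The smallest element of a (nonempty) finite set of natural numbers. -/
def minOf (A : Finset ℕ) : ℕ := sInf (A : Set ℕ)

/-- The minima of the parts of `x` that are not parts of `y`; when `x ⋖ y` these are the minima of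
the two parts of `x` that are merged in `y`. -/
def mergedMins {n : ℕ} (x y : PartitionPoset n) : Finset ℕ :=
  (x.parts \ y.parts).image minOf

/-- The Björner–Gessel labelling: the edge that merges the parts `A` and `B` is labelled by
`max (min A) (min B)`. -/
def bjornerGessel (n : ℕ) (x y : PartitionPoset n) : ℕ := (mergedMins x y).sup id

/-- Read a chain of partitions from bottom to top, `T a` being the tree that has been built on the
part with minimum `a`: an edge that merges the parts with minima `a < b` grafts their trees on a
new vertex. -/
def buildTrees {n : ℕ} : (ℕ → BTree) → List (PartitionPoset n) → (ℕ → BTree)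
  | T, [] => T
  | T, [_] => T
  | T, x :: y :: l =>
    buildTrees
      (Function.update T (minOf (mergedMins x y))
        (.node (T (minOf (mergedMins x y))) (T ((mergedMins x y).sup id)))) (y :: l)

/-- The map `π` that sends a maximal chain of the partition poset (a levelled tree) to the
underlying tree, by forgetting the levels. -/
def forgetLevels {n : ℕ} (c : List (PartitionPoset n)) : BTree := buildTrees .leaf c 1

/-! ## The order on trees and the PBW basis produced by an edge labelling -/

/-- `a` is directly below `b`: `a ≠ b` are the trees of two adjacent maximal chains
`r·(g ⋖ x ⋖ h)·s` and `r·(g ⋖ y ⋖ h)·s`, where `g ⋖ x ⋖ h` is the unique increasing chain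
(minimal in the lexicographic order) of the interval `[g, h]`. -/
def TreeStep (lab : ∀ n, PartitionPoset n → PartitionPoset n → ℕ) (n : ℕ)
    (a b : ShTree n) : Prop :=
  a ≠ b ∧ ∃ (r s : List (PartitionPoset n)) (g x y h : PartitionPoset n),
    IsMaxChainOf ⊥ ⊤ (r ++ [g, x, h] ++ s) ∧
    IsMaxChainOf ⊥ ⊤ (r ++ [g, y, h] ++ s) ∧
    forgetLevels (r ++ [g, x, h] ++ s) = a.1 ∧
    forgetLevels (r ++ [g, y, h] ++ s) = b.1 ∧
    IsMinIncreasingChain (lab n) g h [g, x, h]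

/-- The order on trees: the reflexive and transitive closure of `TreeStep`. -/
def TreeLE (lab : ∀ n, PartitionPoset n → PartitionPoset n → ℕ) (n : ℕ) :
    ShTree n → ShTree n → Prop :=
  Relation.ReflTransGen (TreeStep lab n)

/-- The PBW basis produced by the labelling `lab`: the trees that are minimal for `TreeLE lab`,
i.e. the normal forms of the rewriting system that replaces a tree by a smaller one. -/
def pbwBasisOf (lab : ∀ n, PartitionPoset n → PartitionPoset n → ℕ) (n : ℕ) : Set (ShTree n) :=
  {a | ∀ b : ShTree n, TreeLE lab n b a → b = a}

end

/-! ## Partitions through the minima of their parts -/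

/-! A partition is encoded by the function `rep` sending each element to the minimum of its part. A
cover merges the parts with minima a < b. It deletes b from the set of minima, and its
Björner–Gessel label is b. So a maximal chain of [x, y] is a sequence of pairs (a, b), and its label
word is an arrangement without repetition of the fixed set `mins x \ mins y`. An increasing chain
must first delete the smallest b of this set. Its partner a < b is then still a minimum of y, so a
is forced to be the minimum of the part of b in y. Induction gives existence and uniqueness, and any
other chain either starts with a larger label or shares its first edge
(`exists_isMinIncreasingChain`).

On trees, the order is the closure of a local rewriting: (A B) C, with min A < min B < min C, lies
below (A C) B and A (B C). An interval of length two either merges three parts into one, which gives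
exactly these moves, or merges two disjoint pairs, whose two orders give the same tree
(`reflTransGen_of_diamond`). Conversely, any local move is seen on a pair of adjacent chains: the
three subtrees are built first, then the two merges are made, then the rest (`treeStep_of_step`).
Hence `treeLE_iff`. Each move upwards strictly increases the leaf word lexicographically, or keeps
it and increases a weight, so the closure is antisymmetric. Compatibility with composition holds
because composition is a monotone substitution.

A minimal tree has only (1 2) 3 as edge restriction, and a tree with this property is the increasing
left comb. Since the sets of trees are finite, some minimal tree lies below every tree, so there is
exactly one minimal tree in each arity n ≥ 1, and it lies below all others; no separate confluence
argument is needed. The increasing chain from bottom to top merges 2, 3, …, n successively into the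
part of 1, and its tree is the same comb.

Finally, every rewriting move is an equality in Com (`Step.treeCongr`), so the class of the comb
spans. The sum of the coefficients vanishes on the ideal and is 1 on a tree, so this class has no
torsion: each component with n ≥ 1 is free of rank one. -/

namespace PartitionPoset

/-- The minimum of the part of `x` that contains `i`. -/
noncomputable def rep {n : ℕ} (x : PartitionPoset n) (i : ℕ) : ℕ := minOf (x.part i)

/-- The set of minima of the parts of `x`. -/
noncomputable def mins {n : ℕ} (x : PartitionPoset n) : Finset ℕ :=
  (Finset.Icc 1 n).filter fun i => rep x i = i

variable {n : ℕ} {x y z : PartitionPoset n} {a b c d i j : ℕ}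

theorem minOf_mem {A : Finset ℕ} (h : A.Nonempty) : minOf A ∈ A := by
  have := Nat.sInf_mem (s := (A : Set ℕ)) h
  exact this

theorem minOf_le {A : Finset ℕ} (h : a ∈ A) : minOf A ≤ a := Nat.sInf_le (by exact h)

theorem rep_mem_part (hi : i ∈ Finset.Icc 1 n) : rep x i ∈ x.part i :=
  minOf_mem (x.part_nonempty.2 hi)

theorem rep_mem (hi : i ∈ Finset.Icc 1 n) : rep x i ∈ Finset.Icc 1 n :=
  x.part_subset i (rep_mem_part hi)

theorem rep_le (hi : i ∈ Finset.Icc 1 n) : rep x i ≤ i := minOf_le (x.mem_part hi)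

theorem part_rep (hi : i ∈ Finset.Icc 1 n) : x.part (rep x i) = x.part i :=
  (x.mem_part_iff_part_eq_part (rep_mem hi) hi).1 (rep_mem_part hi)

theorem rep_rep (hi : i ∈ Finset.Icc 1 n) : rep x (rep x i) = rep x i := by
  rw [rep, part_rep hi]; rfl

theorem rep_eq_iff (hi : i ∈ Finset.Icc 1 n) (hj : j ∈ Finset.Icc 1 n) :
    rep x i = rep x j ↔ x.part i = x.part j :=
  ⟨fun h => by rw [← part_rep hi, h, part_rep hj], fun h => by rw [rep, h]; rfl⟩

theorem mem_part_iff (hi : i ∈ Finset.Icc 1 n) :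
    j ∈ x.part i ↔ j ∈ Finset.Icc 1 n ∧ rep x j = rep x i := by
  constructor
  · intro h
    have hj := x.part_subset i h
    exact ⟨hj, (rep_eq_iff hj hi).2 ((x.mem_part_iff_part_eq_part hj hi).1 h)⟩
  · rintro ⟨hj, h⟩
    exact (x.mem_part_iff_part_eq_part hj hi).2 ((rep_eq_iff hj hi).1 h)

theorem mem_mins : i ∈ mins x ↔ i ∈ Finset.Icc 1 n ∧ rep x i = i := by simp [mins]

theorem rep_mem_mins (hi : i ∈ Finset.Icc 1 n) : rep x i ∈ mins x :=
  mem_mins.2 ⟨rep_mem hi, rep_rep hi⟩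

/-- If x refines y, an element and its representative in x lie in the same part of y. Refinement
thus becomes an equation between functions, and antisymmetry makes `rep` determine the partition. -/
theorem le_iff_rep : x ≤ y ↔ ∀ i ∈ Finset.Icc 1 n, rep y (rep x i) = rep y i := by
  constructor
  · intro h i hi
    obtain ⟨C, hC, hC'⟩ := h (x.part_mem.2 hi)
    rw [rep_eq_iff (rep_mem hi) hi, y.part_eq_of_mem hC (hC' (rep_mem_part hi)),
      y.part_eq_of_mem hC (hC' (x.mem_part hi))]
  · intro h A hA
    obtain ⟨i, hi⟩ := x.nonempty_of_mem_parts hA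
    have hi' := x.subset hA hi
    refine ⟨y.part i, y.part_mem.2 hi', fun j hj => ?_⟩
    have hj' := x.subset hA hj
    have hij : rep x j = rep x i := (rep_eq_iff hj' hi').2 <| by
      rw [x.part_eq_of_mem hA hj, x.part_eq_of_mem hA hi]
    rw [mem_part_iff hi', ← h i hi', ← h j hj', hij]
    exact ⟨hj', rfl⟩

theorem ext_rep (h : ∀ i ∈ Finset.Icc 1 n, rep x i = rep y i) : x = y :=
  le_antisymm (le_iff_rep.2 fun i hi => by rw [h i hi, rep_rep hi])
    (le_iff_rep.2 fun i hi => by rw [← h i hi, rep_rep hi])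

theorem mins_anti (h : x ≤ y) : mins y ⊆ mins x := by
  intro i hi
  rw [mem_mins] at hi ⊢
  refine ⟨hi.1, le_antisymm (rep_le hi.1) ?_⟩
  have := rep_le (x := y) (rep_mem (x := x) hi.1)
  rwa [le_iff_rep.1 h i hi.1, hi.2] at this

/-- If every minimum of x survives in y, then `rep y i = rep y (rep x i) = rep x i`. The set of
minima therefore detects strictness along comparable partitions, which is how covers and lengths are
controlled below. -/
theorem eq_of_le_of_mins_subset (h : x ≤ y) (h' : mins x ⊆ mins y) : x = y :=
  ext_rep fun i hi => by
    rw [← le_iff_rep.1 h i hi, (mem_mins.1 (h' (rep_mem_mins hi))).2]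

theorem rep_bot (hi : i ∈ Finset.Icc 1 n) : rep (⊥ : PartitionPoset n) i = i := by
  have : (⊥ : PartitionPoset n).part i = {i} :=
    Finpartition.part_eq_of_mem _ (Finpartition.mem_bot_iff.2 ⟨i, hi, rfl⟩) (by simp)
  rw [rep, this, minOf, Finset.coe_singleton, csInf_singleton]

theorem mins_bot : mins (⊥ : PartitionPoset n) = Finset.Icc 1 n := by
  ext i
  rw [mem_mins]
  exact ⟨fun h => h.1, fun h => ⟨h, rep_bot h⟩⟩

/-- An inclusion instead of an equality, so that arity 0, where there are no minima, is covered too.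
-/
theorem eq_top_of_mins_subset (h : mins x ⊆ {1}) : x = ⊤ := by
  refine eq_of_le_of_mins_subset le_top fun i hi => ?_
  have h1 := Finset.mem_singleton.1 (h hi)
  subst h1
  have h2 := (mem_mins.1 hi).1
  exact mem_mins.2 ⟨h2, le_antisymm (rep_le h2) (Finset.mem_Icc.1 (rep_mem h2)).1⟩

theorem mins_top : mins (⊤ : PartitionPoset n) ⊆ {1} := by
  intro i hi
  obtain ⟨hi, h⟩ := mem_mins.1 hi
  have h1 : 1 ∈ Finset.Icc 1 n := by simp at hi ⊢; omega
  have h2 := Finpartition.parts_top_subsingleton (Finset.Icc 1 n)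
    (Finpartition.part_mem _ |>.2 hi) (Finpartition.part_mem _ |>.2 h1)
  rw [Finset.mem_singleton, ← h, (rep_eq_iff hi h1).2 h2]
  exact le_antisymm (rep_le h1) (Finset.mem_Icc.1 (rep_mem h1)).1

/-! ### Covering relations as merges of two parts -/

open Classical in
/-- The partition obtained by merging the parts of `x` with minima `a` and `b`. -/
noncomputable def merge (x : PartitionPoset n) (a b : ℕ) : PartitionPoset n :=
  Finpartition.ofSetSetoid (Setoid.ker fun i => if rep x i = b then a else rep x i) _

theorem mem_part_merge (hi : i ∈ Finset.Icc 1 n) : j ∈ (merge x a b).part i ↔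
    j ∈ Finset.Icc 1 n ∧
      (if rep x i = b then a else rep x i) = (if rep x j = b then a else rep x j) := by
  classical
  rw [merge, Finpartition.mem_part_ofSetSetoid_iff_rel]
  simp only [hi, true_and]
  rfl

theorem rep_merge (ha : a ∈ mins x) (hab : a < b) (hi : i ∈ Finset.Icc 1 n) :
    rep (merge x a b) i = if rep x i = b then a else rep x i := by
  have ha' := mem_mins.1 ha
  have hne : rep x a ≠ b := by rw [ha'.2]; exact hab.ne
  apply le_antisymm
  · apply minOf_le
    rw [mem_part_merge hi]
    by_cases h : rep x i = b
    · rw [if_pos h, if_neg hne]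
      exact ⟨ha'.1, ha'.2.symm⟩
    · simpa only [if_neg h, rep_rep hi, and_true] using rep_mem hi
  · have h := rep_mem_part (x := merge x a b) hi
    rw [mem_part_merge hi] at h
    refine h.2.trans_le ?_
    have h3 := rep_le (x := x) h.1
    split_ifs with h2
    · exact hab.le.trans (h2.symm.trans_le h3)
    · exact h3

theorem mins_merge (ha : a ∈ mins x) (hab : a < b) :
    mins (merge x a b) = (mins x).erase b := by
  ext i
  rw [Finset.mem_erase, mem_mins, mem_mins]
  constructor
  · rintro ⟨hi, h⟩
    rw [rep_merge ha hab hi] at h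
    split_ifs at h with h2
    · subst h; exact absurd ((mem_mins.1 ha).2.symm.trans h2) hab.ne
    · exact ⟨fun h3 => h2 (h.trans h3), hi, h⟩
  · rintro ⟨h1, hi, h⟩
    exact ⟨hi, by rw [rep_merge ha hab hi, if_neg (by rwa [h]), h]⟩

theorem le_merge (ha : a ∈ mins x) (hab : a < b) : x ≤ merge x a b :=
  le_iff_rep.2 fun i hi => by
    rw [rep_merge ha hab (rep_mem hi), rep_merge ha hab hi, rep_rep hi]

theorem merge_ne (ha : a ∈ mins x) (hb : b ∈ mins x) (hab : a < b) : x ≠ merge x a b := by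
  intro h
  have := mins_merge ha hab
  rw [← h] at this
  rw [this] at hb
  simp at hb

theorem merge_le (h : x ≤ y) (ha : a ∈ mins x) (hb : b ∈ mins x) (hab : a < b) :
    merge x a b ≤ y ↔ rep y a = rep y b := by
  rw [le_iff_rep]
  have hb' := mem_mins.1 hb
  constructor
  · intro h2
    have h3 := h2 b hb'.1
    rwa [rep_merge ha hab hb'.1, if_pos hb'.2] at h3
  · intro h2 i hi
    rw [rep_merge ha hab hi]
    split_ifs with h3
    · rw [h2, ← h3, le_iff_rep.1 h i hi]
    · exact le_iff_rep.1 h i hi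

/-- Some minimum b of x is lost in y. It can be merged with the minimum of its part in y, which is
smaller and is also a minimum of x. -/
theorem exists_merge_le (h : x < y) :
    ∃ a b, a ∈ mins x ∧ b ∈ mins x ∧ a < b ∧ merge x a b ≤ y := by
  have h1 : ¬ mins x ⊆ mins y := fun h2 => h.ne (eq_of_le_of_mins_subset h.le h2)
  obtain ⟨b, hb, hb'⟩ := Finset.not_subset.1 h1
  have hbn := (mem_mins.1 hb).1
  have ha := rep_mem_mins (x := y) hbn
  have hab : rep y b < b :=
    lt_of_le_of_ne (rep_le hbn) fun h2 => hb' (mem_mins.2 ⟨hbn, h2⟩)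
  exact ⟨_, b, mins_anti h.le ha, hb, hab,
    (merge_le h.le (mins_anti h.le ha) hb hab).2 (rep_rep hbn)⟩

/-- The merge removes a single minimum, so a partition strictly in between would have the same
minima as one of the two ends. -/
theorem covBy_merge (ha : a ∈ mins x) (hb : b ∈ mins x) (hab : a < b) : x ⋖ merge x a b := by
  refine ⟨lt_of_le_of_ne (le_merge ha hab) (merge_ne ha hb hab), fun z hz hz' => ?_⟩
  have h1 : ¬ mins z ⊆ mins (merge x a b) := fun h2 =>
    hz'.ne (eq_of_le_of_mins_subset hz'.le h2)
  obtain ⟨c, hc, hc'⟩ := Finset.not_subset.1 h1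
  have hcx := mins_anti hz.le hc
  rw [mins_merge ha hab, Finset.mem_erase, not_and'] at hc'
  obtain rfl : c = b := not_not.1 (hc' hcx)
  exact hz.ne (eq_of_le_of_mins_subset hz.le fun i hi => by
    by_cases h : i = c
    · exact h ▸ hc
    · exact mins_anti hz'.le (by rw [mins_merge ha hab]; exact Finset.mem_erase.2 ⟨h, hi⟩))

theorem exists_eq_merge_of_covBy (h : x ⋖ y) :
    ∃ a b, a ∈ mins x ∧ b ∈ mins x ∧ a < b ∧ y = merge x a b := by
  obtain ⟨a, b, ha, hb, hab, hle⟩ := exists_merge_le h.lt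
  exact ⟨a, b, ha, hb, hab, ((h.eq_or_eq (le_merge ha hab) hle).resolve_left
    (merge_ne ha hb hab).symm).symm⟩

theorem mem_mergedMins :
    i ∈ mergedMins x y ↔ i ∈ mins x ∧ ¬ x.part i = y.part i := by
  simp only [mergedMins, Finset.mem_image, Finset.mem_sdiff]
  constructor
  · rintro ⟨A, ⟨hA, hA'⟩, rfl⟩
    have h1 := minOf_mem (x.nonempty_of_mem_parts hA)
    have h2 := x.subset hA h1
    have h3 := x.part_eq_of_mem hA h1
    exact ⟨mem_mins.2 ⟨h2, by rw [rep, h3]⟩,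
      fun h4 => hA' (by rw [← h3, h4]; exact y.part_mem.2 h2)⟩
  · rintro ⟨hi, h1⟩
    obtain ⟨hi, h2⟩ := mem_mins.1 hi
    exact ⟨x.part i, ⟨x.part_mem.2 hi, fun h3 => h1 (y.part_eq_of_mem h3 (x.mem_part hi)).symm⟩,
      h2⟩

theorem mergedMins_merge (ha : a ∈ mins x) (hb : b ∈ mins x) (hab : a < b) :
    mergedMins x (merge x a b) = {a, b} := by
  obtain ⟨han, ha'⟩ := mem_mins.1 ha
  obtain ⟨hbn, hb'⟩ := mem_mins.1 hb
  ext i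
  rw [mem_mergedMins, Finset.mem_insert, Finset.mem_singleton]
  constructor
  · rintro ⟨hi, h⟩
    obtain ⟨hi, hi'⟩ := mem_mins.1 hi
    by_contra! h2
    apply h
    ext j
    rw [mem_part_iff hi, mem_part_iff hi, and_congr_right_iff]
    intro hj
    rw [rep_merge ha hab hi, rep_merge ha hab hj, hi', if_neg h2.2]
    split_ifs with h3
    · rw [h3]
      exact ⟨fun h4 => absurd h4.symm h2.2, fun h4 => absurd h4.symm h2.1⟩
    · rfl
  · have key : a ∈ (merge x a b).part b := by
      rw [mem_part_iff hbn, rep_merge ha hab hbn, rep_merge ha hab han, ha', hb', if_pos rfl,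
        if_neg hab.ne]
      exact ⟨han, rfl⟩
    rintro (rfl | rfl)
    · refine ⟨ha, fun h => ?_⟩
      have : b ∈ x.part i := by
        rw [h, mem_part_iff han]
        exact ⟨hbn, ((mem_part_iff hbn).1 key).2.symm⟩
      rw [mem_part_iff han, ha', hb'] at this
      exact hab.ne' this.2
    · refine ⟨hb, fun h => ?_⟩
      rw [← h, mem_part_iff hbn, ha', hb'] at key
      exact hab.ne key.2

theorem bjornerGessel_merge (ha : a ∈ mins x) (hb : b ∈ mins x) (hab : a < b) :
    bjornerGessel n x (merge x a b) = b := by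
  simp [bjornerGessel, mergedMins_merge ha hb hab, hab.le]

theorem minOf_mergedMins_merge (ha : a ∈ mins x) (hb : b ∈ mins x) (hab : a < b) :
    minOf (mergedMins x (merge x a b)) = a := by
  rw [mergedMins_merge ha hb hab]
  refine le_antisymm (minOf_le (by simp)) ?_
  have := minOf_mem (A := {a, b}) (by simp)
  rw [Finset.mem_insert, Finset.mem_singleton] at this
  rcases this with h | h <;> rw [h]
  exact hab.le

/-! ## Maximal chains as sequences of merges -/

/-- Each pair `(a, b)` of the list satisfies `a < b` and consists of elements of the current set of
minima, from which `b` is then removed. -/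
def IsMergeSeq : Finset ℕ → List (ℕ × ℕ) → Prop
  | _, [] => True
  | M, p :: ps => p.1 ∈ M ∧ p.2 ∈ M ∧ p.1 < p.2 ∧ IsMergeSeq (M.erase p.2) ps

/-- The partitions obtained from `x` by successive merges. -/
noncomputable def mergeChain : PartitionPoset n → List (ℕ × ℕ) → List (PartitionPoset n)
  | _, [] => []
  | x, p :: ps => merge x p.1 p.2 :: mergeChain (merge x p.1 p.2) ps

/-- The last partition obtained from `x` by successive merges. -/
noncomputable def mergeEnd (x : PartitionPoset n) (ps : List (ℕ × ℕ)) : PartitionPoset n :=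
  ps.foldl (fun x p => merge x p.1 p.2) x

/-- The trees obtained by successive merges. -/
def mergeTrees (T : ℕ → BTree) (ps : List (ℕ × ℕ)) : ℕ → BTree :=
  ps.foldl (fun T p => Function.update T p.1 (.node (T p.1) (T p.2))) T

theorem mergeEnd_cons (x : PartitionPoset n) (p : ℕ × ℕ) (ps : List (ℕ × ℕ)) :
    mergeEnd x (p :: ps) = mergeEnd (merge x p.1 p.2) ps := rfl

theorem mergeTrees_cons (T : ℕ → BTree) (p : ℕ × ℕ) (ps : List (ℕ × ℕ)) :
    mergeTrees T (p :: ps) =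
      mergeTrees (Function.update T p.1 (.node (T p.1) (T p.2))) ps := rfl

theorem mergeTrees_append (T : ℕ → BTree) (ps qs : List (ℕ × ℕ)) :
    mergeTrees T (ps ++ qs) = mergeTrees (mergeTrees T ps) qs := List.foldl_append

theorem mergeEnd_append (x : PartitionPoset n) (ps qs : List (ℕ × ℕ)) :
    mergeEnd x (ps ++ qs) = mergeEnd (mergeEnd x ps) qs := List.foldl_append

theorem mergeChain_append (x : PartitionPoset n) (ps qs : List (ℕ × ℕ)) :
    mergeChain x (ps ++ qs) = mergeChain x ps ++ mergeChain (mergeEnd x ps) qs := by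
  induction ps generalizing x with
  | nil => rfl
  | cons p ps ih => simp [mergeChain, ih, mergeEnd_cons]

theorem exists_mergeChain_eq_append (x : PartitionPoset n) (ps : List (ℕ × ℕ)) :
    ∃ r, x :: mergeChain x ps = r ++ [mergeEnd x ps] := by
  induction ps generalizing x with
  | nil => exact ⟨[], rfl⟩
  | cons p ps ih =>
    obtain ⟨r, hr⟩ := ih (merge x p.1 p.2)
    exact ⟨x :: r, by rw [mergeChain, hr]; rfl⟩

theorem isMergeSeq_append {M : Finset ℕ} {ps qs : List (ℕ × ℕ)} :
    IsMergeSeq M (ps ++ qs) ↔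
      IsMergeSeq M ps ∧ IsMergeSeq (M \ (ps.map Prod.snd).toFinset) qs := by
  induction ps generalizing M with
  | nil => simp [IsMergeSeq]
  | cons p ps ih =>
    have : M \ ((p :: ps).map Prod.snd).toFinset =
        M.erase p.2 \ (ps.map Prod.snd).toFinset := by
      ext i; simp; tauto
    rw [this, List.cons_append, IsMergeSeq, IsMergeSeq, ih]
    tauto

theorem mins_mergeEnd {ps : List (ℕ × ℕ)} (h : IsMergeSeq (mins x) ps) :
    mins (mergeEnd x ps) = mins x \ (ps.map Prod.snd).toFinset := by
  induction ps generalizing x with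
  | nil => simp [mergeEnd]
  | cons p ps ih =>
    obtain ⟨h1, h2, h3, h4⟩ := h
    rw [← mins_merge h1 h3] at h4
    rw [mergeEnd_cons, ih h4, mins_merge h1 h3]
    ext i; simp; tauto

theorem IsMergeSeq.nodup {M : Finset ℕ} {ps : List (ℕ × ℕ)} (h : IsMergeSeq M ps) :
    (ps.map Prod.snd).Nodup ∧ ∀ b ∈ ps.map Prod.snd, b ∈ M := by
  induction ps generalizing M with
  | nil => simp
  | cons p ps ih =>
    obtain ⟨h1, h2, h3, h4⟩ := h
    obtain ⟨h5, h6⟩ := ih h4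
    simp only [List.map_cons, List.nodup_cons, List.mem_cons]
    refine ⟨⟨fun h => ?_, h5⟩, ?_⟩
    · simpa using h6 _ h
    · rintro b (rfl | h)
      · exact h2
      · exact Finset.mem_of_mem_erase (h6 _ h)

theorem le_mergeEnd {ps : List (ℕ × ℕ)} (h : IsMergeSeq (mins x) ps) : x ≤ mergeEnd x ps := by
  induction ps generalizing x with
  | nil => exact le_rfl
  | cons p ps ih =>
    obtain ⟨h1, h2, h3, h4⟩ := h
    rw [← mins_merge h1 h3] at h4
    exact (le_merge h1 h3).trans (ih h4)

theorem mergeChain_isMaxChainOf {ps : List (ℕ × ℕ)} (h : IsMergeSeq (mins x) ps) :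
    IsMaxChainOf x (mergeEnd x ps) (x :: mergeChain x ps) := by
  refine ⟨?_, rfl, ?_⟩
  · induction ps generalizing x with
    | nil => exact List.isChain_singleton _
    | cons p ps ih =>
      obtain ⟨h1, h2, h3, h4⟩ := h
      rw [← mins_merge h1 h3] at h4
      exact List.isChain_cons_cons.2 ⟨covBy_merge h1 h2 h3, ih h4⟩
  · obtain ⟨r, hr⟩ := exists_mergeChain_eq_append x ps
    simp [hr]

theorem exists_eq_mergeChain {l : List (PartitionPoset n)} (h : (x :: l).IsChain (· ⋖ ·)) :
    ∃ ps, IsMergeSeq (mins x) ps ∧ l = mergeChain x ps := by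
  induction l generalizing x with
  | nil => exact ⟨[], trivial, rfl⟩
  | cons y l ih =>
    obtain ⟨h1, h2⟩ := List.isChain_cons_cons.1 h
    obtain ⟨a, b, ha, hb, hab, rfl⟩ := exists_eq_merge_of_covBy h1
    obtain ⟨ps, hps, rfl⟩ := ih h2
    exact ⟨(a, b) :: ps, ⟨ha, hb, hab, by rwa [← mins_merge ha hab]⟩, rfl⟩

/-- The dictionary used throughout: chains become lists of pairs whose validity depends only on the
set of minima. Labels are then second components, and trees are computed by a fold. -/
theorem isMaxChainOf_iff {c : List (PartitionPoset n)} : IsMaxChainOf x y c ↔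
    ∃ ps, IsMergeSeq (mins x) ps ∧ mergeEnd x ps = y ∧ c = x :: mergeChain x ps := by
  constructor
  · rintro ⟨h1, h2, h3⟩
    cases c with
    | nil => simp at h2
    | cons z l =>
      obtain rfl : z = x := by simpa using h2
      obtain ⟨ps, hps, rfl⟩ := exists_eq_mergeChain h1
      refine ⟨ps, hps, ?_, rfl⟩
      obtain ⟨r, hr⟩ := exists_mergeChain_eq_append z ps
      simpa [hr] using h3
  · rintro ⟨ps, hps, rfl, rfl⟩
    exact mergeChain_isMaxChainOf hps

theorem chainLabels_mergeChain {ps : List (ℕ × ℕ)} (h : IsMergeSeq (mins x) ps) :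
    chainLabels (bjornerGessel n) (x :: mergeChain x ps) = ps.map Prod.snd := by
  induction ps generalizing x with
  | nil => rfl
  | cons p ps ih =>
    obtain ⟨h1, h2, h3, h4⟩ := h
    rw [← mins_merge h1 h3] at h4
    rw [mergeChain, chainLabels, ih h4, bjornerGessel_merge h1 h2 h3]
    rfl

theorem buildTrees_mergeChain {ps : List (ℕ × ℕ)} (T : ℕ → BTree) (h : IsMergeSeq (mins x) ps) :
    buildTrees T (x :: mergeChain x ps) = mergeTrees T ps := by
  induction ps generalizing x T with
  | nil => rfl
  | cons p ps ih =>
    obtain ⟨h1, h2, h3, h4⟩ := h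
    rw [← mins_merge h1 h3] at h4
    have h5 : (mergedMins x (merge x p.1 p.2)).sup id = p.2 := bjornerGessel_merge h1 h2 h3
    rw [mergeChain, buildTrees, minOf_mergedMins_merge h1 h2 h3, h5, ih _ h4]
    rfl

/-! ## The Björner–Gessel labelling is an EL-labelling -/

theorem exists_isMinIncreasingChain (h : x ≤ y) :
    ∃ c, IsMinIncreasingChain (bjornerGessel n) x y c := by
  generalize hm : (mins x \ mins y).card = m
  induction m generalizing x with
  | zero =>
    obtain rfl := eq_of_le_of_mins_subset h
      (Finset.sdiff_eq_empty_iff_subset.1 (Finset.card_eq_zero.1 hm))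
    have key : ∀ c, IsMaxChainOf x x c → c = [x] := by
      intro c hc
      obtain ⟨ps, hps, h1, rfl⟩ := isMaxChainOf_iff.1 hc
      cases ps with
      | nil => rfl
      | cons p ps =>
        have h2 := mins_mergeEnd hps
        have h3 := hps.2.1
        rw [← h1, h2] at h3
        simp at h3
    exact ⟨[x], ⟨List.isChain_singleton _, rfl, rfl⟩, List.isChain_nil, fun c hc _ => key c hc,
      fun c hc hne => absurd (key c hc) hne⟩
  | succ m ih =>
    have hL : (mins x \ mins y).Nonempty := Finset.card_pos.1 (by omega)
    -- The first merge deletes the smallest minimum b that has to disappear, and joins it to `rep y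
    -- b`, the minimum of its part in y.
    obtain ⟨hbx, hby⟩ := Finset.mem_sdiff.1 ((mins x \ mins y).min'_mem hL)
    have hmin : ∀ c ∈ mins x, c ∉ mins y → (mins x \ mins y).min' hL ≤ c :=
      fun c h1 h2 => Finset.min'_le _ _ (Finset.mem_sdiff.2 ⟨h1, h2⟩)
    generalize (mins x \ mins y).min' hL = b at hbx hby hmin
    have hbn := (mem_mins.1 hbx).1
    have hay := rep_mem_mins (x := y) hbn
    have hax := mins_anti h hay
    have hab : rep y b < b :=
      lt_of_le_of_ne (rep_le hbn) fun h2 => hby (mem_mins.2 ⟨hbn, h2⟩)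
    have hle := (merge_le h hax hbx hab).2 (rep_rep hbn)
    have hmm := mins_merge hax hab
    obtain ⟨c, hc⟩ := ih hle (by
      rw [hmm, Finset.erase_sdiff_comm, Finset.card_erase_of_mem
        (Finset.mem_sdiff.2 ⟨hbx, hby⟩), hm]
      rfl)
    obtain ⟨ps, hps, h1, h2⟩ := isMaxChainOf_iff.1 hc.isMaxChain
    have hps' : IsMergeSeq (mins x) ((rep y b, b) :: ps) := ⟨hax, hbx, hab, by rwa [← hmm]⟩
    have hxc : x :: c = x :: mergeChain x ((rep y b, b) :: ps) := by rw [h2]; rfl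
    have hlab : chainLabels (bjornerGessel n) (x :: c) =
        b :: chainLabels (bjornerGessel n) c := by
      rw [hxc, h2, chainLabels_mergeChain hps', chainLabels_mergeChain hps]
      rfl
    have hnot : ∀ {z : PartitionPoset n} {qs : List (ℕ × ℕ)}, IsMergeSeq (mins z) qs →
        mergeEnd z qs = y → ∀ d ∈ qs.map Prod.snd, d ∈ mins z ∧ d ∉ mins y := by
      intro z qs hqs hy d hd
      refine ⟨hqs.nodup.2 d hd, fun h => ?_⟩
      rw [← hy, mins_mergeEnd hqs] at h
      simp only [Finset.mem_sdiff, List.mem_toFinset] at h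
      exact h.2 hd
    -- Any chain either starts with a label above b and meets b later, so that it is neither
    -- increasing nor lexicographically first, or starts with the same edge.
    have hother : ∀ c', IsMaxChainOf x y c' → ∃ p qs, IsMergeSeq (mins x) (p :: qs) ∧
        c' = x :: mergeChain x (p :: qs) ∧ mergeEnd x (p :: qs) = y ∧
        (b < p.2 ∧ b ∈ qs.map Prod.snd ∨ p = (rep y b, b)) := by
      intro c' hc'
      obtain ⟨qs, hqs, hy, rfl⟩ := isMaxChainOf_iff.1 hc'
      cases qs with
      | nil =>
        obtain rfl : x = y := hy
        exact absurd hbx hby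
      | cons p qs =>
        refine ⟨p, qs, hqs, rfl, hy, ?_⟩
        obtain ⟨h3, h4, h5, h6⟩ := id hqs
        have h7 := hnot hqs hy
        rcases (hmin p.2 h4 (h7 _ (by simp)).2).lt_or_eq with h8 | h8
        · refine Or.inl ⟨h8, ?_⟩
          by_contra h9
          apply hby
          rw [← hy, mins_mergeEnd hqs]
          simp only [Finset.mem_sdiff, List.mem_toFinset, List.map_cons, List.mem_cons, not_or]
          exact ⟨hbx, h8.ne, h9⟩
        · right
          rw [← mins_merge h3 h5] at h6
          have h9 : merge x p.1 p.2 ≤ y := hy ▸ le_mergeEnd h6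
          rw [merge_le h h3 h4 h5, ← h8] at h9
          -- The partner is smaller than b, so by minimality of b it is not deleted, and it must be
          -- the representative of b in y.
          have h10 : p.1 ∈ mins y := by
            by_contra h10
            exact (hmin _ h3 h10).not_gt (h8 ▸ h5)
          rw [(mem_mins.1 h10).2] at h9
          exact Prod.ext h9 h8.symm
    have htail : ∀ qs, IsMergeSeq (mins x) ((rep y b, b) :: qs) →
        mergeEnd x ((rep y b, b) :: qs) = y →
        IsMergeSeq (mins (merge x (rep y b) b)) qs ∧
        IsMaxChainOf (merge x (rep y b) b) y
          (merge x (rep y b) b :: mergeChain (merge x (rep y b) b) qs) := by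
      intro qs hqs hy
      have h3 := hqs.2.2.2
      rw [← hmm] at h3
      exact ⟨h3, isMaxChainOf_iff.2 ⟨qs, h3, hy, rfl⟩⟩
    have hps1 : mergeEnd x ((rep y b, b) :: ps) = y := h1
    refine ⟨x :: c, ?_, ?_, ?_, ?_⟩
    · rw [hxc]
      exact isMaxChainOf_iff.2 ⟨_, hps', hps1, rfl⟩
    · have hinc := hc.isIncreasing
      rw [IsIncreasing, h2, chainLabels_mergeChain hps] at hinc
      rw [IsIncreasing, hlab, h2, chainLabels_mergeChain hps, List.isChain_cons]
      refine ⟨fun d hd => ?_, hinc⟩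
      have hd' := hnot hps h1 d (List.mem_of_mem_head? hd)
      rw [hmm, Finset.mem_erase] at hd'
      exact lt_of_le_of_ne (hmin d hd'.1.2 hd'.2) hd'.1.1.symm
    · intro c' hc' hinc
      obtain ⟨p, qs, hqs, rfl, hy, ⟨h3, h4⟩ | rfl⟩ := hother c' hc'
      · rw [IsIncreasing, chainLabels_mergeChain hqs, List.isChain_iff_pairwise,
          List.map_cons, List.pairwise_cons] at hinc
        exact absurd (hinc.1 b h4) h3.not_gt
      · obtain ⟨h3, h4⟩ := htail qs hqs hy
        rw [← hc.unique _ h4 (by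
          rw [IsIncreasing, chainLabels_mergeChain h3]
          rw [IsIncreasing, chainLabels_mergeChain hqs] at hinc
          exact (List.isChain_cons.1 hinc).2)]
        rfl
    · intro c' hc' hne
      obtain ⟨p, qs, hqs, rfl, hy, ⟨h3, h4⟩ | rfl⟩ := hother c' hc'
      · rw [hlab, chainLabels_mergeChain hqs]
        exact List.Lex.rel h3
      · obtain ⟨h3, h4⟩ := htail qs hqs hy
        have h5 := hc.lex _ h4 fun h6 => hne (by rw [← h6]; rfl)
        rw [chainLabels_mergeChain h3] at h5
        rw [hlab, chainLabels_mergeChain hqs]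
        exact List.Lex.cons h5

theorem bjornerGessel_isELLabelling (n : ℕ) : IsELLabelling (bjornerGessel n) :=
  fun _ _ h => exists_isMinIncreasingChain h

end PartitionPoset

/-! ## The rewriting system on trees -/

namespace BTree

/-- `Step a b`: the tree `b` is obtained from `a` by replacing a subtree `(A B) C`, where
`min A < min B < min C`, by `(A C) B` or by `A (B C)`. -/
inductive Step : BTree → BTree → Prop
  | swap (A B C : BTree) : A.minLeaf < B.minLeaf → B.minLeaf < C.minLeaf →
      Step (node (node A B) C) (node (node A C) B)
  | rot (A B C : BTree) : A.minLeaf < B.minLeaf → B.minLeaf < C.minLeaf →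
      Step (node (node A B) C) (node A (node B C))
  | inLeft {l l' : BTree} (r : BTree) : Step l l' → Step (node l r) (node l' r)
  | inRight {r r' : BTree} (l : BTree) : Step r r' → Step (node l r) (node l r')

variable {a b t l r : BTree}

theorem Step.leaves_perm (h : Step a b) : a.leaves.Perm b.leaves := by
  induction h with
  | swap A B C _ _ =>
    simp only [leaves, List.append_assoc]
    exact List.perm_append_comm.append_left _
  | rot A B C _ _ => simp [leaves]
  | inLeft r _ ih => exact ih.append_right _
  | inRight l _ ih => exact ih.append_left _

theorem Step.minLeaf_eq (h : Step a b) : a.minLeaf = b.minLeaf := by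
  induction h with
  | swap A B C _ _ => simp only [minLeaf]; omega
  | rot A B C _ _ => simp only [minLeaf]; omega
  | inLeft r _ ih => simp only [minLeaf, ih]
  | inRight l _ ih => simp only [minLeaf, ih]

theorem Step.isShuffle_iff (h : Step a b) : a.IsShuffle ↔ b.IsShuffle := by
  induction h with
  | swap A B C _ _ =>
    simp only [IsShuffle, minLeaf]
    constructor
    · rintro ⟨_, ⟨_, h1, h2⟩, h3⟩; exact ⟨by omega, ⟨by omega, h1, h3⟩, h2⟩
    · rintro ⟨_, ⟨_, h1, h2⟩, h3⟩; exact ⟨by omega, ⟨by omega, h1, h3⟩, h2⟩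
  | rot A B C _ _ =>
    simp only [IsShuffle, minLeaf]
    constructor
    · rintro ⟨_, ⟨_, h1, h2⟩, h3⟩; exact ⟨by omega, h1, by omega, h2, h3⟩
    · rintro ⟨_, h1, _, h2, h3⟩; exact ⟨by omega, ⟨by omega, h1, h2⟩, h3⟩
  | inLeft r h ih => simp only [IsShuffle, ih, h.minLeaf_eq]
  | inRight l h ih => simp only [IsShuffle, ih, h.minLeaf_eq]

theorem exists_leaves_eq_cons (h : t.IsShuffle) : ∃ w, t.leaves = t.minLeaf :: w := by
  induction t with
  | leaf i => exact ⟨[], rfl⟩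
  | node l r hl _ =>
    obtain ⟨w, hw⟩ := hl h.2.1
    exact ⟨w ++ r.leaves, by rw [leaves, hw, minLeaf, min_eq_left h.1.le]; rfl⟩

/-- The number of leaves above the right inputs, summed over all vertices. -/
def rightWeight : BTree → ℕ
  | leaf _ => 0
  | node l r => l.rightWeight + r.rightWeight + r.leaves.length

/-- Equal lengths exclude that `u` is a proper prefix of `v`, in which case the appended words would
decide. -/
theorem lex_append_of_length_eq {u v : List ℕ} (huv : u.length = v.length) (w w' : List ℕ)
    (h : List.Lex (· < ·) u v) : List.Lex (· < ·) (u ++ w) (v ++ w') := by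
  induction h with
  | nil => simp at huv
  | rel h => exact .rel h
  | cons _ ih => exact .cons (ih (by simpa using huv))

/-- The order in which trees are compared by their words of leaves, and then by weight. -/
def WeightLT (a b : BTree) : Prop :=
  List.Lex (· < ·) a.leaves b.leaves ∨ a.leaves = b.leaves ∧ a.rightWeight < b.rightWeight

theorem WeightLT.irrefl : ¬ WeightLT a a := by
  rintro (h | ⟨_, h⟩)
  · exact (List.lex_irrefl (fun a : ℕ => lt_irrefl a) _) h
  · exact lt_irrefl _ h

theorem WeightLT.trans {c : BTree} (h : WeightLT a b) (h' : WeightLT b c) : WeightLT a c := by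
  rcases h with h | ⟨h1, h2⟩ <;> rcases h' with h' | ⟨h3, h4⟩
  · exact Or.inl (List.lex_trans (fun h h' => lt_trans h h') h h')
  · exact Or.inl (h3 ▸ h)
  · exact Or.inl (h1 ▸ h')
  · exact Or.inr ⟨h1.trans h3, h2.trans h4⟩

/-- The leaf word of a shuffle tree starts with its minimum, so a swap puts min C where min B stood
and the word grows. A rotation keeps the word, and the leaves of C are counted once more as lying
above a right input. -/
theorem Step.weightLT (h : Step a b) (hb : b.IsShuffle) : WeightLT a b := by
  induction h with
  | swap A B C h1 h2 =>
    left
    simp only [leaves, List.append_assoc]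
    obtain ⟨u, hu⟩ := exists_leaves_eq_cons hb.2.2
    obtain ⟨v, hv⟩ := exists_leaves_eq_cons hb.2.1.2.2
    rw [hu, hv]
    exact List.Lex.append_left _ (List.Lex.rel h2) _
  | rot A B C h1 h2 =>
    right
    have := List.length_pos_of_mem C.minLeaf_mem
    simp only [leaves, List.append_assoc, rightWeight, List.length_append, true_and]
    omega
  | @inLeft l l' r h ih =>
    rcases ih hb.2.1 with h3 | ⟨h3, h4⟩
    · exact Or.inl (lex_append_of_length_eq h.leaves_perm.length_eq _ _ h3)
    · exact Or.inr ⟨by simp [leaves, h3], by simp only [rightWeight]; omega⟩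
  | @inRight r r' l h ih =>
    have h5 := h.leaves_perm.length_eq
    rcases ih hb.2.2 with h3 | ⟨h3, h4⟩
    · exact Or.inl (List.Lex.append_left _ h3 _)
    · exact Or.inr ⟨by simp [leaves, h3], by simp only [rightWeight]; omega⟩

open Relation in
theorem reflTransGen_node {l l' r r' : BTree} (h : ReflTransGen Step l l')
    (h' : ReflTransGen Step r r') : ReflTransGen Step (node l r) (node l' r') :=
  (h.lift (fun t => node t r) fun _ _ => Step.inLeft r).trans
    (h'.lift (fun t => node l' t) fun _ _ => Step.inRight l')

open Relation in
theorem weightLT_of_reflTransGen (h : ReflTransGen Step a b) (hb : b.IsShuffle) :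
    a = b ∨ WeightLT a b := by
  induction h with
  | refl => exact Or.inl rfl
  | tail _ h1 ih =>
    have h2 := h1.weightLT hb
    rcases ih (h1.isShuffle_iff.2 hb) with rfl | h3
    · exact Or.inr h2
    · exact Or.inr (h3.trans h2)

/-! ### Substitution -/

theorem bind_congr {σ τ : ℕ → BTree} (h : ∀ i ∈ t.leaves, σ i = τ i) : t.bind σ = t.bind τ := by
  induction t with
  | leaf i => exact h i (by simp [leaves])
  | node l r hl hr =>
    simp only [bind]
    rw [hl fun i hi => h i (by simp [leaves, hi]), hr fun i hi => h i (by simp [leaves, hi])]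

theorem bind_leaf (t : BTree) : t.bind leaf = t := by
  induction t with
  | leaf i => rfl
  | node l r hl hr => simp [bind, hl, hr]

theorem bind_bind (σ τ : ℕ → BTree) (t : BTree) :
    (t.bind σ).bind τ = t.bind fun i => (σ i).bind τ := by
  induction t with
  | leaf i => rfl
  | node l r hl hr => simp [bind, hl, hr]

theorem leaves_map (φ : ℕ → ℕ) (t : BTree) : (t.map φ).leaves = t.leaves.map φ := by
  rw [map, leaves_bind, List.map_eq_flatMap]; rfl

/-- A move only tests inequalities between minima of subtrees, and these survive a substitution
whose minima are a strictly increasing function of the leaf. -/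
theorem Step.bind {σ : ℕ → BTree} {f : ℕ → ℕ} {S : Set ℕ} (hf : StrictMonoOn f S)
    (hσ : ∀ i ∈ S, (σ i).minLeaf = f i) (h : Step a b) (ha : ∀ i ∈ a.leaves, i ∈ S) :
    Step (a.bind σ) (b.bind σ) := by
  have key : ∀ {A B : BTree}, (∀ i ∈ A.leaves, i ∈ S) → (∀ i ∈ B.leaves, i ∈ S) →
      A.minLeaf < B.minLeaf → (A.bind σ).minLeaf < (B.bind σ).minLeaf := by
    intro A B hA hB hAB
    rw [minLeaf_bind hf hσ A hA, minLeaf_bind hf hσ B hB]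
    exact hf (hA _ A.minLeaf_mem) (hB _ B.minLeaf_mem) hAB
  induction h with
  | swap A B C h1 h2 =>
    simp only [leaves, List.mem_append, or_imp, forall_and] at ha
    exact .swap _ _ _ (key ha.1.1 ha.1.2 h1) (key ha.1.2 ha.2 h2)
  | rot A B C h1 h2 =>
    simp only [leaves, List.mem_append, or_imp, forall_and] at ha
    exact .rot _ _ _ (key ha.1.1 ha.1.2 h1) (key ha.1.2 ha.2 h2)
  | inLeft r _ ih =>
    simp only [leaves, List.mem_append, or_imp, forall_and] at ha
    exact .inLeft _ (ih ha.1)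
  | inRight l _ ih =>
    simp only [leaves, List.mem_append, or_imp, forall_and] at ha
    exact .inRight _ (ih ha.2)

open Relation in
theorem reflTransGen_bind_left {σ τ : ℕ → BTree}
    (h : ∀ i ∈ t.leaves, ReflTransGen Step (σ i) (τ i)) :
    ReflTransGen Step (t.bind σ) (t.bind τ) := by
  induction t with
  | leaf i => exact h i (by simp [leaves])
  | node l r hl hr =>
    simp only [leaves, List.mem_append, or_imp, forall_and] at h
    exact reflTransGen_node (hl h.1) (hr h.2)

open Relation in
theorem reflTransGen_bind_right {σ : ℕ → BTree} {f : ℕ → ℕ} {S : Set ℕ} (hf : StrictMonoOn f S)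
    (hσ : ∀ i ∈ S, (σ i).minLeaf = f i) (h : ReflTransGen Step a b)
    (ha : ∀ i ∈ a.leaves, i ∈ S) : ReflTransGen Step (a.bind σ) (b.bind σ) := by
  suffices ReflTransGen Step (a.bind σ) (b.bind σ) ∧ ∀ i ∈ b.leaves, i ∈ S from this.1
  induction h with
  | refl => exact ⟨.refl, ha⟩
  | tail _ h1 ih =>
    exact ⟨ih.1.tail (h1.bind hf hσ ih.2), fun i hi => ih.2 i (h1.leaves_perm.mem_iff.2 hi)⟩

/-! ### Forests as sequences of merges -/

open PartitionPoset

/-- The trees of the forest `F` have pairwise distinct leaves, and performing the merges `ps` builds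
each of them at its smallest leaf, without changing the trees at the numbers that are not leaves
of `F`. -/
structure Realizes (ps : List (ℕ × ℕ)) (F : List BTree) : Prop where
  nodup : (F.flatMap leaves).Nodup
  eq_bind : ∀ T : ℕ → BTree, ∀ t ∈ F, mergeTrees T ps t.minLeaf = t.bind T
  eq_self : ∀ T : ℕ → BTree, ∀ i ∉ F.flatMap leaves, mergeTrees T ps i = T i
  isMergeSeq : ∀ M : Finset ℕ, (∀ i ∈ F.flatMap leaves, i ∈ M) → IsMergeSeq M ps
  mem_snd : ∀ i, i ∈ ps.map Prod.snd ↔ ∃ t ∈ F, i ∈ t.leaves ∧ i ≠ t.minLeaf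

theorem Realizes.leaf (i : ℕ) : Realizes [] [leaf i] where
  nodup := by simp [leaves]
  eq_bind T t ht := by rw [List.mem_singleton.1 ht]; rfl
  eq_self _ _ _ := rfl
  isMergeSeq _ _ := trivial
  mem_snd j := by simp [leaves, minLeaf]

theorem Realizes.perm {ps : List (ℕ × ℕ)} {F G : List BTree} (h : Realizes ps F)
    (hp : F.Perm G) : Realizes ps G where
  nodup := (hp.flatMap_right _).nodup_iff.1 h.nodup
  eq_bind T t ht := h.eq_bind T t (hp.mem_iff.2 ht)
  eq_self T i hi := h.eq_self T i fun h => hi ((hp.flatMap_right _).mem_iff.1 h)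
  isMergeSeq M hM := h.isMergeSeq M fun i hi => hM i ((hp.flatMap_right _).mem_iff.1 hi)
  mem_snd i := by rw [h.mem_snd]; simp only [hp.mem_iff]

/-- The second sequence starts from the family left by the first one, which is why `eq_bind` allows
an arbitrary initial family. Disjointness keeps the two constructions from interfering. -/
theorem Realizes.append {ps qs : List (ℕ × ℕ)} {F G : List BTree} (hF : Realizes ps F)
    (hG : Realizes qs G) (hd : (F.flatMap leaves).Disjoint (G.flatMap leaves)) :
    Realizes (ps ++ qs) (F ++ G) where
  nodup := by
    rw [List.flatMap_append]
    exact List.nodup_append'.2 ⟨hF.nodup, hG.nodup, hd⟩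
  eq_bind T t ht := by
    rw [mergeTrees_append]
    rcases List.mem_append.1 ht with ht | ht
    · rw [hG.eq_self _ _ fun h => hd (List.mem_flatMap.2 ⟨t, ht, t.minLeaf_mem⟩) h,
        hF.eq_bind T t ht]
    · rw [hG.eq_bind _ t ht]
      exact bind_congr fun i hi =>
        hF.eq_self _ _ fun hi' => hd hi' (List.mem_flatMap.2 ⟨t, ht, hi⟩)
  eq_self T i hi := by
    rw [List.flatMap_append, List.mem_append, not_or] at hi
    rw [mergeTrees_append, hG.eq_self _ _ hi.2, hF.eq_self _ _ hi.1]
  isMergeSeq M hM := by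
    simp only [List.flatMap_append, List.mem_append, or_imp, forall_and] at hM
    refine isMergeSeq_append.2 ⟨hF.isMergeSeq M hM.1, hG.isMergeSeq _ fun i hi => ?_⟩
    rw [Finset.mem_sdiff, List.mem_toFinset, hF.mem_snd]
    refine ⟨hM.2 i hi, ?_⟩
    rintro ⟨t, ht, hit, -⟩
    exact hd (List.mem_flatMap.2 ⟨t, ht, hit⟩) hi
  mem_snd i := by
    simp only [List.map_append, List.mem_append, hF.mem_snd, hG.mem_snd, or_and_right, exists_or]

theorem Realizes.node {ps : List (ℕ × ℕ)} {F : List BTree} (h : Realizes ps (l :: r :: F))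
    (hlr : l.minLeaf < r.minLeaf) :
    Realizes (ps ++ [(l.minLeaf, r.minLeaf)]) (node l r :: F) := by
  have hl1 := l.minLeaf_mem
  have hr1 := r.minLeaf_mem
  have hmin : (BTree.node l r).minLeaf = l.minLeaf := min_eq_left hlr.le
  have hfl : (BTree.node l r :: F).flatMap leaves = (l :: r :: F).flatMap leaves := by
    simp [leaves]
  have hnd := h.nodup
  simp only [List.flatMap_cons, List.nodup_append', List.disjoint_append_right] at hnd
  obtain ⟨_, ⟨_, _, hrF⟩, hdlr, hlF⟩ := hnd
  have happ : ∀ T i, mergeTrees T (ps ++ [(l.minLeaf, r.minLeaf)]) i =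
      if i = l.minLeaf then .node (mergeTrees T ps l.minLeaf) (mergeTrees T ps r.minLeaf)
      else mergeTrees T ps i := by
    intro T i
    rw [mergeTrees_append]
    simp only [mergeTrees, List.foldl_cons, List.foldl_nil, Function.update_apply]
  refine ⟨hfl ▸ h.nodup, fun T t ht => ?_, fun T i hi => ?_, fun M hM => ?_, fun i => ?_⟩
  · rw [happ]
    rcases List.mem_cons.1 ht with rfl | ht
    · rw [hmin, if_pos rfl, h.eq_bind T l (by simp), h.eq_bind T r (by simp)]
      rfl
    · rw [if_neg, h.eq_bind T t (by simp [ht])]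
      intro h2
      exact hlF hl1 (List.mem_flatMap.2 ⟨t, ht, h2 ▸ t.minLeaf_mem⟩)
  · rw [hfl] at hi
    rw [happ, if_neg, h.eq_self T i hi]
    rintro rfl
    simp [hl1] at hi
  · rw [hfl] at hM
    refine isMergeSeq_append.2 ⟨h.isMergeSeq M hM, ?_⟩
    have h1 : l.minLeaf ∈ M := hM _ (by simp [hl1])
    have h2 : r.minLeaf ∈ M := hM _ (by simp [hr1])
    -- The root of a tree of the forest has not been absorbed by any earlier merge; `mem_snd` is
    -- there to provide this, here for both trees to be joined.
    have h3 : l.minLeaf ∉ ps.map Prod.snd := by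
      rw [h.mem_snd]
      rintro ⟨t, ht, h4, h5⟩
      rcases List.mem_cons.1 ht with rfl | ht
      · exact h5 rfl
      rcases List.mem_cons.1 ht with rfl | ht
      · exact hdlr hl1 h4
      · exact hlF hl1 (List.mem_flatMap.2 ⟨t, ht, h4⟩)
    have h4 : r.minLeaf ∉ ps.map Prod.snd := by
      rw [h.mem_snd]
      rintro ⟨t, ht, h4, h5⟩
      rcases List.mem_cons.1 ht with rfl | ht
      · exact hdlr h4 hr1
      rcases List.mem_cons.1 ht with rfl | ht
      · exact h5 rfl
      · exact hrF hr1 (List.mem_flatMap.2 ⟨t, ht, h4⟩)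
    simp only [IsMergeSeq, Finset.mem_sdiff, List.mem_toFinset]
    exact ⟨⟨h1, h3⟩, ⟨h2, h4⟩, hlr, trivial⟩
  · simp only [List.map_append, List.mem_append, h.mem_snd, List.map_cons, List.map_nil,
      List.not_mem_nil, or_false, List.mem_cons, or_and_right, exists_or, exists_eq_left, hmin, leaves]
    have h3 : l.minLeaf ∉ r.leaves := fun h => hdlr hl1 h
    constructor
    · rintro ((h4 | h4 | h4) | rfl)
      · exact Or.inl (Or.inl h4)
      · exact Or.inl (Or.inr ⟨h4.1, fun h5 => h3 (h5 ▸ h4.1)⟩)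
      · exact Or.inr h4
      · exact Or.inl (Or.inr ⟨hr1, hlr.ne'⟩)
    · rintro ((h4 | h4) | h4)
      · exact Or.inl (Or.inl h4)
      · by_cases h5 : i = r.minLeaf
        · exact Or.inr h5
        · exact Or.inl (Or.inr (Or.inl ⟨h4.1, h5⟩))
      · exact Or.inl (Or.inr (Or.inr h4))

theorem exists_realizes (h : t.IsShuffle) (hn : t.leaves.Nodup) : ∃ ps, Realizes ps [t] := by
  induction t with
  | leaf i => exact ⟨[], .leaf i⟩
  | node l r hl hr =>
    obtain ⟨h1, h2, h3⟩ := List.nodup_append'.1 hn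
    obtain ⟨ps, hps⟩ := hl h.2.1 h1
    obtain ⟨qs, hqs⟩ := hr h.2.2 h2
    exact ⟨_, (hps.append hqs (by simpa using h3)).node h.1⟩

/-- Both trees are built by sequences with the same beginning P and the same end Q: P contains the
construction of A, B and C, the middle two merges join them in one of three ways, and Q does what
remains. Sharing Q is possible because a move preserves the minimum. -/
theorem Step.exists_realizes (h : Step a b) (ha : a.IsShuffle) (hn : a.leaves.Nodup) :
    ∃ P Q i j k q, i < j ∧ j < k ∧ (q = [(i, k), (i, j)] ∨ q = [(j, k), (i, j)]) ∧
      Realizes (P ++ [(i, j), (i, k)] ++ Q) [a] ∧ Realizes (P ++ q ++ Q) [b] := by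
  have forest : ∀ {A B C : BTree}, (BTree.node (BTree.node A B) C).IsShuffle →
      (BTree.node (BTree.node A B) C).leaves.Nodup → ∃ P, Realizes P [A, B, C] := by
    intro A B C h hn
    obtain ⟨h1, h2, h3⟩ := List.nodup_append'.1 hn
    obtain ⟨h4, h5, h6⟩ := List.nodup_append'.1 h1
    obtain ⟨P, hP⟩ := BTree.exists_realizes h.2.1.2.1 h4
    obtain ⟨Q, hQ⟩ := BTree.exists_realizes h.2.1.2.2 h5
    obtain ⟨R, hR⟩ := BTree.exists_realizes h.2.2 h2
    exact ⟨_, (hP.append hQ (by simpa using h6)).append hR (by simpa [leaves] using h3)⟩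
  induction h with
  | swap A B C h1 h2 =>
    obtain ⟨P, hP⟩ := forest ha hn
    refine ⟨P, [], A.minLeaf, B.minLeaf, C.minLeaf, _, h1, h2, Or.inl rfl, ?_, ?_⟩
    · have := (hP.node h1).node (by rw [minLeaf]; omega)
      simpa [minLeaf, h1.le] using this
    · have := ((hP.perm ((List.Perm.swap _ _ _).cons _)).node (h1.trans h2)).node
        (by rw [minLeaf]; omega)
      simpa [minLeaf, (h1.trans h2).le] using this
  | rot A B C h1 h2 =>
    obtain ⟨P, hP⟩ := forest ha hn
    refine ⟨P, [], A.minLeaf, B.minLeaf, C.minLeaf, _, h1, h2, Or.inr rfl, ?_, ?_⟩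
    · have := (hP.node h1).node (by rw [minLeaf]; omega)
      simpa [minLeaf, h1.le] using this
    · have := (((hP.perm (List.perm_append_comm (l₁ := [A]) (l₂ := [B, C]))).node h2).perm
        (List.Perm.swap _ _ _)).node (by rw [minLeaf]; omega)
      simpa [minLeaf, h2.le] using this
  | @inLeft l l' r h ih =>
    obtain ⟨h1, h2, h3⟩ := List.nodup_append'.1 hn
    obtain ⟨P, Q, i, j, k, q, hij, hjk, hq, h4, h5⟩ := ih ha.2.1 h1
    obtain ⟨R, hR⟩ := BTree.exists_realizes ha.2.2 h2
    refine ⟨P, Q ++ R ++ [(l.minLeaf, r.minLeaf)], i, j, k, q, hij, hjk, hq, ?_, ?_⟩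
    · simpa using (h4.append hR (by simpa using h3)).node ha.1
    · rw [h.minLeaf_eq]
      have h6 : l'.leaves.Disjoint r.leaves := fun i hi => h3 (h.leaves_perm.mem_iff.2 hi)
      simpa using (h5.append hR (by simpa using h6)).node (h.minLeaf_eq ▸ ha.1)
  | @inRight r r' l h ih =>
    obtain ⟨h1, h2, h3⟩ := List.nodup_append'.1 hn
    obtain ⟨P, Q, i, j, k, q, hij, hjk, hq, h4, h5⟩ := ih ha.2.2 h2
    obtain ⟨R, hR⟩ := BTree.exists_realizes ha.2.1 h1
    refine ⟨R ++ P, Q ++ [(l.minLeaf, r.minLeaf)], i, j, k, q, hij, hjk, hq, ?_, ?_⟩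
    · simpa using (hR.append h4 (by simpa using h3)).node ha.1
    · rw [h.minLeaf_eq]
      have h6 : l.leaves.Disjoint r'.leaves :=
        fun i hi hi' => h3 hi (h.leaves_perm.mem_iff.2 hi')
      simpa using (hR.append h5 (by simpa using h6)).node (h.minLeaf_eq ▸ ha.1)

end BTree

/-! ## Adjacent chains and the rewriting system -/

open PartitionPoset Relation

namespace PartitionPoset

variable {n : ℕ} {x y : PartitionPoset n} {a b c i j k : ℕ}

/-- The three ways of joining the parts with minima i < j < k all end at the partition where i
represents the three of them. -/
theorem mergeEnd_pair (hi : i ∈ mins x) (hj : j ∈ mins x) (hij : i < j)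
    (hjk : j < k) {q : List (ℕ × ℕ)} (hq : q = [(i, k), (i, j)] ∨ q = [(j, k), (i, j)]) :
    mergeEnd x q = mergeEnd x [(i, j), (i, k)] := by
  have h1 : i ∈ mins (merge x i j) := by
    rw [mins_merge hi hij]; exact Finset.mem_erase.2 ⟨hij.ne, hi⟩
  have h2 : i ∈ mins (merge x i k) := by
    rw [mins_merge hi (hij.trans hjk)]; exact Finset.mem_erase.2 ⟨(hij.trans hjk).ne, hi⟩
  have h3 : i ∈ mins (merge x j k) := by
    rw [mins_merge hj hjk]; exact Finset.mem_erase.2 ⟨(hij.trans hjk).ne, hi⟩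
  refine ext_rep fun m hm => ?_
  rcases hq with rfl | rfl <;> simp only [mergeEnd, List.foldl_cons, List.foldl_nil]
  · rw [rep_merge h1 (hij.trans hjk) hm, rep_merge h2 hij hm, rep_merge hi hij hm,
      rep_merge hi (hij.trans hjk) hm]
    split_ifs <;> omega
  · rw [rep_merge h1 (hij.trans hjk) hm, rep_merge h3 hij hm, rep_merge hi hij hm,
      rep_merge hj hjk hm]
    split_ifs <;> omega

/-- By `mem_snd`, all leaves except the smallest are absorbed, so 1 is the only possible minimum at
the end. -/
theorem mergeEnd_bot_eq_top {ps : List (ℕ × ℕ)} {t : BTree}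
    (ht : t.leaves.Perm (List.range' 1 n)) (h : BTree.Realizes ps [t]) :
    IsMergeSeq (mins (⊥ : PartitionPoset n)) ps ∧
      mergeEnd (⊥ : PartitionPoset n) ps = ⊤ ∧ t.minLeaf = 1 := by
  have hmem : ∀ i, i ∈ t.leaves ↔ i ∈ Finset.Icc 1 n := fun i => by
    rw [ht.mem_iff, List.mem_range'_1, Finset.mem_Icc]; omega
  have hmin : t.minLeaf = 1 := by
    have h1 := Finset.mem_Icc.1 ((hmem _).1 t.minLeaf_mem)
    exact le_antisymm (t.minLeaf_le ((hmem 1).2 (Finset.mem_Icc.2 ⟨le_rfl, by omega⟩))) h1.1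
  have hseq : IsMergeSeq (mins (⊥ : PartitionPoset n)) ps :=
    h.isMergeSeq _ fun i hi => by
      rw [mins_bot]; exact (hmem i).1 (by simpa using hi)
  refine ⟨hseq, eq_top_of_mins_subset fun i hi => ?_, hmin⟩
  rw [mins_mergeEnd hseq, mins_bot, Finset.mem_sdiff, List.mem_toFinset, h.mem_snd] at hi
  by_contra h1
  exact hi.2 ⟨t, by simp, (hmem i).2 hi.1, by rw [hmin]; simpa using h1⟩

theorem forgetLevels_mergeChain {ps : List (ℕ × ℕ)} {t : BTree}
    (ht : t.leaves.Perm (List.range' 1 n)) (h : BTree.Realizes ps [t]) :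
    IsMaxChainOf ⊥ ⊤ ((⊥ : PartitionPoset n) :: mergeChain ⊥ ps) ∧
      forgetLevels ((⊥ : PartitionPoset n) :: mergeChain ⊥ ps) = t := by
  obtain ⟨h1, h2, h3⟩ := mergeEnd_bot_eq_top ht h
  refine ⟨h2 ▸ mergeChain_isMaxChainOf h1, ?_⟩
  rw [forgetLevels, buildTrees_mergeChain _ h1, ← h3, h.eq_bind _ t (by simp), BTree.bind_leaf]

theorem treeStep_of_step {a b : ShTree n} (h : BTree.Step a.1 b.1) :
    TreeStep bjornerGessel n a b := by
  refine ⟨?_, ?_⟩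
  · rintro rfl
    exact BTree.WeightLT.irrefl (h.weightLT a.2.1)
  obtain ⟨P, Q, i, j, k, q, hij, hjk, hq, h1, h2⟩ :=
    h.exists_realizes a.2.1 (a.2.2.nodup_iff.2 List.nodup_range')
  obtain ⟨hc1, ht1⟩ := forgetLevels_mergeChain a.2.2 h1
  obtain ⟨hc2, ht2⟩ := forgetLevels_mergeChain b.2.2 h2
  obtain ⟨hs1, -, -⟩ := mergeEnd_bot_eq_top a.2.2 h1
  obtain ⟨hs2, -, -⟩ := mergeEnd_bot_eq_top b.2.2 h2
  obtain ⟨⟨hsP, hsp⟩, -⟩ := (isMergeSeq_append.trans (and_congr_left' isMergeSeq_append)).1 hs1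
  rw [← mins_mergeEnd hsP] at hsp
  obtain ⟨r, hr⟩ := exists_mergeChain_eq_append (⊥ : PartitionPoset n) P
  set g := mergeEnd (⊥ : PartitionPoset n) P with hg
  have hi := hsp.1
  have hj := hsp.2.1
  have hend := mergeEnd_pair hi hj hij hjk hq
  -- The chain is cut at g, the partition reached after P, and at the common end of the two middle
  -- merges.
  have hdec : ∀ p : List (ℕ × ℕ), (⊥ : PartitionPoset n) :: mergeChain ⊥ (P ++ p ++ Q) =
      r ++ (g :: mergeChain g p) ++ mergeChain (mergeEnd g p) Q := by
    intro p
    rw [mergeChain_append, mergeChain_append, mergeEnd_append, ← hg, ← List.cons_append,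
      ← List.cons_append, hr]
    simp
  obtain ⟨y, hy⟩ : ∃ y, mergeChain g q = [y, mergeEnd g q] := by
    rcases hq with rfl | rfl <;> exact ⟨_, rfl⟩
  have hmc := mergeChain_isMaxChainOf hsp
  rw [hdec] at hc1 hc2 ht1 ht2
  rw [hy, hend] at hc2 ht2
  refine ⟨r, _, g, _, y, _, hc1, hc2, ht1, ht2, ?_⟩
  obtain ⟨c, hc⟩ := exists_isMinIncreasingChain (le_mergeEnd hsp)
  -- The middle labels are j < k, so uniqueness identifies this chain with the one of the EL
  -- property.
  have hcc : g :: mergeChain g [(i, j), (i, k)] = c := by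
    refine hc.unique _ hmc ?_
    rw [IsIncreasing, chainLabels_mergeChain hsp]
    simpa using hjk
  rw [← hcc] at hc
  exact hc

/-! ### From adjacent chains to rewriting moves -/

theorem buildTrees_append_cons (T : ℕ → BTree) (r l : List (PartitionPoset n))
    (g : PartitionPoset n) :
    buildTrees T (r ++ g :: l) = buildTrees (buildTrees T (r ++ [g])) (g :: l) := by
  induction r generalizing T with
  | nil => rfl
  | cons z r ih =>
    cases r with
    | nil => rfl
    | cons z' r => exact ih _

theorem minLeaf_mergeTrees {M : Finset ℕ} {ps : List (ℕ × ℕ)} {T : ℕ → BTree}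
    (h : IsMergeSeq M ps) (hT : ∀ m ∈ M, (T m).minLeaf = m) :
    ∀ m ∈ M \ (ps.map Prod.snd).toFinset, (mergeTrees T ps m).minLeaf = m := by
  induction ps generalizing M T with
  | nil => simpa [mergeTrees] using hT
  | cons p ps ih =>
    obtain ⟨h1, h2, h3, h4⟩ := h
    intro m hm
    refine ih h4 (fun m hm => ?_) m (by simp at hm ⊢; tauto)
    have hm' := Finset.mem_of_mem_erase hm
    simp only [Function.update_apply]
    split_ifs with h5
    · rw [BTree.minLeaf, hT _ h1, hT _ h2, min_eq_left h3.le, h5]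
    · exact hT m hm'

/-- Merges only graft trees on new vertices, so rewritings obtained below a partition propagate
along the rest of the chain. -/
theorem reflTransGen_mergeTrees {M : Finset ℕ} {ps : List (ℕ × ℕ)} {T T' : ℕ → BTree}
    (h : IsMergeSeq M ps) (hT : ∀ m ∈ M, ReflTransGen BTree.Step (T m) (T' m)) :
    ∀ m ∈ M \ (ps.map Prod.snd).toFinset,
      ReflTransGen BTree.Step (mergeTrees T ps m) (mergeTrees T' ps m) := by
  induction ps generalizing M T T' with
  | nil => simpa [mergeTrees] using hT
  | cons p ps ih =>
    obtain ⟨h1, h2, h3, h4⟩ := h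
    intro m hm
    refine ih h4 (fun m hm => ?_) m (by simp at hm ⊢; tauto)
    have hm' := Finset.mem_of_mem_erase hm
    simp only [Function.update_apply]
    split_ifs with h5
    · exact BTree.reflTransGen_node (hT _ h1) (hT _ h2)
    · exact hT m hm'

/-- Both chains delete the same two minima, and a second chain different from the increasing one
deletes them in decreasing order. Three cases remain: two disjoint merges exchanged (same trees),
the same target for both (`swap`), or the two deleted parts joined first (`rot`). -/
theorem reflTransGen_of_diamond {g x y h : PartitionPoset n} {T : ℕ → BTree}
    (hT : ∀ m ∈ mins g, (T m).minLeaf = m)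
    (hx : IsMinIncreasingChain (bjornerGessel n) g h [g, x, h]) (hy : IsMaxChainOf g h [g, y, h]) :
    ∀ m ∈ mins h, ReflTransGen BTree.Step (buildTrees T [g, x, h] m)
      (buildTrees T [g, y, h] m) := by
  have hpair : ∀ {z : PartitionPoset n}, IsMaxChainOf g h [g, z, h] → ∃ a b c d,
      IsMergeSeq (mins g) [(a, b), (c, d)] ∧ mergeEnd g [(a, b), (c, d)] = h ∧
      [g, z, h] = g :: mergeChain g [(a, b), (c, d)] := by
    intro z hz
    obtain ⟨ps, h1, h2, h3⟩ := isMaxChainOf_iff.1 hz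
    match ps, h1, h2, h3 with
    | [], _, _, h3 => simp [mergeChain] at h3
    | [_], _, _, h3 => simp [mergeChain] at h3
    | [(a, b), (c, d)], h1, h2, h3 => exact ⟨a, b, c, d, h1, h2, h3⟩
    | _ :: _ :: _ :: _, _, _, h3 => simp [mergeChain] at h3
  obtain ⟨a, b, c, d, h1, h2, h3⟩ := hpair hx.isMaxChain
  obtain ⟨a', b', c', d', h1', h2', h3'⟩ := hpair hy
  have hinc := hx.isIncreasing
  rw [IsIncreasing, h3, chainLabels_mergeChain h1] at hinc
  have hbd : b < d := by simpa using hinc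
  by_cases hbd' : b' < d'
  · rw [hx.unique _ hy (by
      rw [IsIncreasing, h3', chainLabels_mergeChain h1']; simpa using hbd')]
    exact fun _ _ => .refl
  have hmins := mins_mergeEnd h1
  have hmins' := mins_mergeEnd h1'
  rw [h2] at hmins
  rw [h2'] at hmins'
  have hset : ∀ m ∈ mins g, (m = b ∨ m = d) ↔ (m = b' ∨ m = d') := by
    intro m hm
    -- The same membership is expanded on each side along a different chain.
    have : m ∈ mins h ↔ m ∈ mins h := Iff.rfl
    conv at this => lhs; rw [hmins]
    conv at this => rhs; rw [hmins']
    simp only [Finset.mem_sdiff, hm, true_and, List.mem_toFinset, List.map_cons, List.map_nil,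
      List.mem_cons, List.not_mem_nil, or_false] at this
    exact not_iff_not.1 this
  rw [h3, h3', buildTrees_mergeChain _ h1, buildTrees_mergeChain _ h1']
  simp only [IsMergeSeq, Finset.mem_erase] at h1 h1'
  obtain ⟨ha, hb, hab, ⟨hcb, hc⟩, ⟨hdb, hd⟩, hcd, -⟩ := h1
  obtain ⟨ha', hb', hab', ⟨hcb', hc'⟩, ⟨hdb', hd'⟩, hcd', -⟩ := h1'
  obtain ⟨rfl, rfl⟩ : b' = d ∧ d' = b := by
    have e1 := (hset b' hb').2 (Or.inl rfl)
    have e2 := (hset d' hd').2 (Or.inr rfl)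
    omega
  have hrep : ∀ m ∈ mins g, rep h m = if (if m = d' then a else m) = b' then c
      else if m = d' then a else m := by
    intro m hm
    obtain ⟨hm1, hm2⟩ := mem_mins.1 hm
    rw [← h2, mergeEnd_cons, mergeEnd_cons, mergeEnd, List.foldl_nil,
      rep_merge (by rw [mins_merge ha hab]; exact Finset.mem_erase.2 ⟨hcb, hc⟩) hcd hm1,
      rep_merge ha hab hm1, hm2]
  have hrep' : ∀ m ∈ mins g, rep h m = if (if m = b' then a' else m) = d' then c'
      else if m = b' then a' else m := by
    intro m hm
    obtain ⟨hm1, hm2⟩ := mem_mins.1 hm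
    rw [← h2', mergeEnd_cons, mergeEnd_cons, mergeEnd, List.foldl_nil,
      rep_merge (by rw [mins_merge ha' hab']; exact Finset.mem_erase.2 ⟨hcb', hc'⟩) hcd' hm1,
      rep_merge ha' hab' hm1, hm2]
  have e1 := (hrep _ hb').symm.trans (hrep' _ hb')
  have e2 := (hrep _ hd').symm.trans (hrep' _ hd')
  -- The common end h assigns the same representatives to the two deleted minima, which leaves only
  -- these possible partners in the second chain.
  have hcase : c' = a ∧ (a' = c ∨ a' = d' ∧ a = c) := by
    split_ifs at e1 e2 <;> omega
  obtain ⟨rfl, hcase⟩ := hcase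
  intro m hm
  rw [hmins] at hm
  simp only [Finset.mem_sdiff, List.mem_toFinset, List.map_cons, List.map_nil,
      List.mem_cons, List.not_mem_nil, or_false, not_or] at hm
  have hab2 : c' ≠ b' := by omega
  have hTa := hT _ ha
  have hTb := hT _ hd'
  have hTd := hT _ hb'
  simp only [mergeTrees, List.foldl_cons, List.foldl_nil]
  rcases hcase with rfl | ⟨rfl, rfl⟩
  · by_cases hac : c' = a'
    · subst hac
      rw [Function.update_apply, Function.update_apply (Function.update _ _ _)]
      split_ifs with h6
      · simp only [Function.update_self, 
          Function.update_of_ne hab.ne', Function.update_of_ne hab'.ne']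
        exact .single (.swap _ _ _ (by omega) (by omega))
      · rw [Function.update_of_ne h6, Function.update_of_ne h6]
    -- Disjoint merges: the two updates commute, so no move is needed.
    · rw [Function.update_of_ne (Ne.symm hac), Function.update_of_ne hab2.symm,
        Function.update_of_ne hac, Function.update_of_ne hcb.symm,
        Function.update_comm hac]
  · rw [Function.update_self, Function.update_of_ne hab2.symm, Function.update_self,
      Function.update_of_ne hab.ne]
    rw [Function.update_apply, Function.update_apply (Function.update _ _ _)]
    split_ifs with h6
    · exact .single (.rot _ _ _ (by omega) (by omega))
    · rw [Function.update_of_ne h6, Function.update_of_ne hm.2.1]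

theorem reflTransGen_of_treeStep {a b : ShTree n} (h : TreeStep bjornerGessel n a b) :
    ReflTransGen BTree.Step a.1 b.1 := by
  obtain ⟨-, r, s, g, x, y, h, hc1, hc2, ht1, ht2, hmin⟩ := h
  have hsplit : ∀ z, (r ++ [g, z, h] ++ s : List (PartitionPoset n)) = (r ++ [g]) ++ z :: h :: s :=
    fun z => by simp
  have hbuild : ∀ z T, buildTrees T (r ++ [g, z, h] ++ s) =
      buildTrees (buildTrees (buildTrees T (r ++ [g])) [g, z, h]) (h :: s) := by
    intro z T
    have : r ++ [g, z, h] ++ s = r ++ g :: (z :: h :: s) := by simp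
    rw [this, buildTrees_append_cons]
    exact buildTrees_append_cons _ [g, z] s h
  have hy : IsMaxChainOf g h [g, y, h] := by
    refine ⟨?_, rfl, rfl⟩
    have h1 := hc2.1
    exact h1.infix ⟨r, s, rfl⟩
  have hr : ∀ m ∈ mins g, (buildTrees BTree.leaf (r ++ [g]) m).minLeaf = m := by
    have h1 : (r ++ [g]).IsChain (· ⋖ ·) := hc1.1.infix ⟨[], x :: h :: s, by simp⟩
    have h2 : (r ++ [g]).head? = some ⊥ := by
      have := hc1.2.1
      cases r <;> simpa using this
    obtain ⟨ps, h3, h4, h5⟩ := isMaxChainOf_iff.1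
      (⟨h1, h2, by simp⟩ : IsMaxChainOf ⊥ g (r ++ [g]))
    rw [h5, buildTrees_mergeChain _ h3, ← h4, mins_mergeEnd h3]
    exact minLeaf_mergeTrees h3 fun _ _ => rfl
  have h1 : IsMaxChainOf h ⊤ (h :: s) := by
    refine ⟨hc1.1.infix ⟨r ++ [g, x], [], by simp⟩, rfl, ?_⟩
    have := hc1.2.2
    simpa [List.getLast?_append, List.getLast?_cons] using this
  obtain ⟨ps, h3, h4, h5⟩ := isMaxChainOf_iff.1 h1
  have h6 := reflTransGen_mergeTrees h3 (reflTransGen_of_diamond hr hmin hy)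
  rw [← mins_mergeEnd h3, h4] at h6
  rw [← ht1, ← ht2, forgetLevels, forgetLevels, hbuild, hbuild, h5, buildTrees_mergeChain _ h3,
    buildTrees_mergeChain _ h3]
  have hn : 1 ∈ Finset.Icc 1 n := by
    have := (a.mem_leaves _).1 a.1.minLeaf_mem
    exact Finset.mem_Icc.2 ⟨le_rfl, this.1.trans this.2⟩
  apply h6
  have h7 := rep_mem_mins (x := (⊤ : PartitionPoset n)) hn
  rwa [Finset.mem_singleton.1 (mins_top h7)] at h7

/-! ### The order on trees as a rewriting order -/

/-- The tree with the same leaves as `b` that is obtained by rewriting. -/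
theorem exists_shTree_of_step {t : BTree} {b : ShTree n} (h : BTree.Step t b.1) :
    ∃ a : ShTree n, a.1 = t :=
  ⟨⟨t, h.isShuffle_iff.2 b.2.1, h.leaves_perm.trans b.2.2⟩, rfl⟩

theorem treeLE_iff {a b : ShTree n} :
    TreeLE bjornerGessel n a b ↔ ReflTransGen BTree.Step a.1 b.1 := by
  constructor
  · intro h
    induction h with
    | refl => exact .refl
    | tail _ h1 ih => exact ih.trans (reflTransGen_of_treeStep h1)
  · intro h
    obtain ⟨b, hb⟩ := b
    change ReflTransGen BTree.Step a.1 b at h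
    induction h with
    | refl => exact .refl
    | @tail t b h1 h2 ih =>
      obtain ⟨c, rfl⟩ := exists_shTree_of_step (b := ⟨b, hb⟩) h2
      exact (ih c.2).tail (treeStep_of_step h2)

theorem treeLE_antisymm {a b : ShTree n} (h : TreeLE bjornerGessel n a b)
    (h' : TreeLE bjornerGessel n b a) : a = b := by
  rw [treeLE_iff] at h h'
  rcases BTree.weightLT_of_reflTransGen h b.2.1 with h1 | h1
  · exact Subtype.ext h1
  rcases BTree.weightLT_of_reflTransGen h' a.2.1 with h2 | h2
  · exact (Subtype.ext h2).symm
  · exact absurd (h1.trans h2) BTree.WeightLT.irrefl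

theorem treeLE_comp {m n p : ℕ} (w : PointedShuffle m n p) {α α' : ShTree m} {β β' : ShTree n}
    (hα : TreeLE bjornerGessel m α α') (hβ : TreeLE bjornerGessel n β β') :
    TreeLE bjornerGessel p (ShTree.comp w α β) (ShTree.comp w α' β') := by
  rw [treeLE_iff] at hα hβ ⊢
  have hβn : ∀ i ∈ β.1.leaves, i ∈ Set.Icc 1 n := fun i => (β.mem_leaves i).1
  have hmin : β.1.minLeaf = 1 := by
    have h1 := hβn _ β.1.minLeaf_mem
    exact le_antisymm (β.1.minLeaf_le ((β.mem_leaves 1).2 ⟨le_rfl, h1.1.trans h1.2⟩)) h1.1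
  -- The outer tree is rewritten first with β fixed, then the grafted copy of β.
  refine (BTree.reflTransGen_bind_right w.f_strictMono (fun i _ => ?_) hα
    fun i => (α.mem_leaves i).1).trans (BTree.reflTransGen_bind_left fun i _ => ?_)
  · unfold ShTree.graftAt
    split_ifs with h
    · rw [BTree.map, BTree.minLeaf_bind w.g_strictMono (fun _ _ => rfl) _ hβn, hmin, w.pointed, h]
    · rfl
  · unfold ShTree.graftAt
    split_ifs with h
    · exact BTree.reflTransGen_bind_right w.g_strictMono (fun _ _ => rfl) hβ hβn
    · exact .refl

end PartitionPoset

/-! ## Normal forms -/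

namespace BTree

variable {t l r : BTree}

theorem standardize_of_lt {a b c : ℕ} (hab : a < b) (hbc : b < c) :
    standardize (node (node (leaf a) (leaf b)) (leaf c)) = ShTree.tree12_3.1 := by
  have hac := hab.trans hbc
  simp [standardize, map, bind, leaves, ShTree.tree12_3, Finset.filter_insert,
    Finset.filter_singleton, hab.le, hbc.le, hac.le, hab.not_ge, hbc.not_ge, hac.not_ge, hab.ne,
    hbc.ne, hac.ne]

/-- If c ≤ b, the rank of c would be at most that of b, but these ranks are 3 and 2. -/
theorem lt_of_standardize_eq {a b c : ℕ}
    (h : standardize (node (node (leaf a) (leaf b)) (leaf c)) = ShTree.tree12_3.1) : b < c := by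
  simp only [standardize, map, bind, ShTree.tree12_3, node.injEq, leaf.injEq] at h
  by_contra! h1
  have : ((node (node (leaf a) (leaf b)) (leaf c)).leaves.toFinset.filter (· ≤ c)).card ≤
      ((node (node (leaf a) (leaf b)) (leaf c)).leaves.toFinset.filter (· ≤ b)).card :=
    Finset.card_le_card (Finset.monotone_filter_right _ fun _ _ h2 => le_trans h2 h1)
  omega

/-- A shuffle tree whose restriction to some edge is not `(1 2) 3` can be rewritten. -/
theorem EdgeRestriction.eq_or_exists_step {s : BTree} (h : EdgeRestriction t s)
    (ht : t.IsShuffle) (hn : t.leaves.Nodup) : s = ShTree.tree12_3.1 ∨ ∃ a, Step a t := by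
  induction h with
  | left a b c =>
    obtain ⟨h1, ⟨h2, -, -⟩, -⟩ := ht
    obtain ⟨-, -, h3⟩ := List.nodup_append'.1 hn
    rw [minLeaf, min_eq_left h2.le] at h1
    have h4 : b.minLeaf ≠ c.minLeaf := fun h =>
      h3 (List.mem_append_right _ b.minLeaf_mem) (h ▸ c.minLeaf_mem)
    rcases h4.lt_or_gt with h5 | h5
    · exact Or.inl (standardize_of_lt h2 h5)
    · exact Or.inr ⟨_, .swap a c b h1 h5⟩
  | right a b c =>
    obtain ⟨h1, -, h2, -, -⟩ := ht
    rw [minLeaf, min_eq_left h2.le] at h1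
    exact Or.inr ⟨_, .rot a b c h1 h2⟩
  | inLeft r _ ih =>
    exact (ih ht.2.1 (List.nodup_append'.1 hn).1).imp_right fun ⟨a, h⟩ => ⟨_, h.inLeft r⟩
  | inRight l _ ih =>
    exact (ih ht.2.2 (List.nodup_append'.1 hn).2.1).imp_right fun ⟨a, h⟩ => ⟨_, h.inRight l⟩

/-! ### Increasing left combs as the only candidates for normal forms -/

/-- Left combs with leaves increasing from left to right. -/
inductive IsIncreasingComb : BTree → Prop
  | leaf (i : ℕ) : IsIncreasingComb (leaf i)
  | node {l : BTree} {j : ℕ} : IsIncreasingComb l → (∀ i ∈ l.leaves, i < j) →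
      IsIncreasingComb (node l (.leaf j))

/-- An edge into a right input never restricts to (1 2) 3, so every right input is a leaf. The left
edges then compare consecutive right leaves. -/
theorem isIncreasingComb_of_edges (ht : t.IsShuffle)
    (h : ∀ s, EdgeRestriction t s → s = ShTree.tree12_3.1) : IsIncreasingComb t := by
  induction t with
  | leaf i => exact .leaf i
  | node l r hl _ =>
    have hl' := hl ht.2.1 fun s hs => h s (hs.inLeft r)
    cases r with
    | node b c =>
      have := h _ (.right l b c)
      simp [standardize, map, bind, ShTree.tree12_3] at this
    | leaf j =>
      refine .node hl' fun i hi => ?_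
      cases hl' with
      | leaf k =>
        have := ht.1
        simp only [leaves, List.mem_singleton] at hi
        rwa [hi]
      | @node l k hl2 hk =>
        have h1 : k < j := lt_of_standardize_eq (h _ (.left l (.leaf k) (.leaf j)))
        simp only [leaves, List.mem_append, List.mem_singleton] at hi
        rcases hi with hi | rfl
        · exact (hk i hi).trans h1
        · exact h1

theorem IsIncreasingComb.sorted (h : IsIncreasingComb t) : t.leaves.Pairwise (· < ·) := by
  induction h with
  | leaf i => simp [leaves]
  | node _ h1 ih => simpa [leaves, List.pairwise_append, ih] using h1

theorem IsIncreasingComb.eq_leftComb {n : ℕ} (h : IsIncreasingComb t)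
    (hp : t.leaves.Perm (List.range' 1 n)) : t = leftComb n := by
  have heq : t.leaves = List.range' 1 n :=
    hp.eq_of_pairwise (fun _ _ _ _ h h' => absurd h h'.not_gt) h.sorted List.pairwise_lt_range'
  clear hp
  induction h generalizing n with
  | leaf i =>
    have := congrArg List.length heq
    simp only [leaves, List.length_cons, List.length_nil, List.length_range'] at this
    subst this
    simpa [leaves, leftComb] using heq
  | @node l j _ _ ih =>
    cases n with
    | zero => simp [leaves] at heq
    | succ n =>
      rw [leaves, List.range'_concat] at heq
      obtain ⟨h1, h2⟩ := List.append_inj' heq rfl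
      rw [ih h1]
      cases n with
      | zero =>
        have := l.minLeaf_mem
        simp [h1] at this
      | succ n =>
        simp only [leaves, List.cons.injEq, and_true] at h2
        rw [leftComb, h2]
        congr 2
        omega

theorem leftComb_leaves (n : ℕ) (hn : 1 ≤ n) : (leftComb n).leaves = List.range' 1 n := by
  induction n, hn using Nat.le_induction with
  | base => rfl
  | succ n hn ih =>
    obtain ⟨m, rfl⟩ := Nat.exists_eq_add_of_le' hn
    rw [List.range'_concat, ← ih, leftComb, leaves, leaves]
    congr 2
    omega

theorem leftComb_isShuffle (n : ℕ) (hn : 1 ≤ n) :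
    (leftComb n).IsShuffle ∧ (leftComb n).minLeaf = 1 := by
  induction n, hn using Nat.le_induction with
  | base => exact ⟨trivial, rfl⟩
  | succ n hn ih =>
    obtain ⟨m, rfl⟩ := Nat.exists_eq_add_of_le' hn
    simp only [leftComb, IsShuffle, minLeaf, ih.1, ih.2]
    simp

/-- Induction on the number of leaves, which drops strictly in both inputs of a vertex. This yields
finiteness of `ShTree n`, hence minimal trees below any tree. -/
theorem finite_setOf_length_le (n m : ℕ) :
    {t : BTree | t.leaves.length ≤ m ∧ ∀ i ∈ t.leaves, i ≤ n}.Finite := by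
  induction m with
  | zero =>
    refine Set.finite_empty.subset fun t ht => ?_
    exact absurd ht.1 (List.length_pos_of_mem t.minLeaf_mem).not_ge
  | succ m ih =>
    refine ((Set.finite_Iic n).image leaf |>.union (ih.image2 node ih)).subset ?_
    rintro (i | ⟨l, r⟩) ⟨h1, h2⟩
    · exact Or.inl ⟨i, h2 i (by simp [leaves]), rfl⟩
    · have h3 := List.length_pos_of_mem l.minLeaf_mem
      have h4 := List.length_pos_of_mem r.minLeaf_mem
      simp only [leaves, List.length_append, List.mem_append, or_imp, forall_and] at h1 h2
      exact Or.inr ⟨l, ⟨by omega, h2.1⟩, r, ⟨by omega, h2.2⟩, rfl⟩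

end BTree

instance (n : ℕ) : Finite (ShTree n) := by
  refine Set.Finite.subset (BTree.finite_setOf_length_le n n) ?_
  rintro t ⟨-, ht⟩
  refine ⟨by simp [ht.length_eq], fun i hi => ?_⟩
  have := List.mem_range'_1.1 (ht.mem_iff.1 hi)
  omega

namespace PartitionPoset

variable {n : ℕ}

theorem exists_mem_pbwBasisOf (a : ShTree n) :
    ∃ b ∈ pbwBasisOf bjornerGessel n, TreeLE bjornerGessel n b a := by
  let _ : PartialOrder (ShTree n) :=
    { le := TreeLE bjornerGessel n
      le_refl := fun _ => .refl
      le_trans := fun _ _ _ h h' => Relation.ReflTransGen.trans h h'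
      le_antisymm := fun _ _ h h' => treeLE_antisymm h h' }
  obtain ⟨b, hb, hm⟩ := (Set.toFinite (Set.univ : Set (ShTree n))).exists_le_minimal
    (Set.mem_univ a)
  exact ⟨b, fun c hc => le_antisymm hc (hm.2 trivial hc), hb⟩

theorem edgeRestriction_of_mem_pbwBasisOf {a : ShTree n} (ha : a ∈ pbwBasisOf bjornerGessel n)
    {s : BTree} (h : BTree.EdgeRestriction a.1 s) : s = ShTree.tree12_3.1 := by
  refine (h.eq_or_exists_step a.2.1 (a.2.2.nodup_iff.2 List.nodup_range')).resolve_right ?_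
  rintro ⟨t, ht⟩
  obtain ⟨b, rfl⟩ := exists_shTree_of_step ht
  obtain rfl := ha b (treeLE_iff.2 (.single ht))
  exact BTree.WeightLT.irrefl (ht.weightLT b.2.1)

theorem eq_leftComb_of_edges {a : ShTree n}
    (h : ∀ s, BTree.EdgeRestriction a.1 s → s = ShTree.tree12_3.1) : a.1 = BTree.leftComb n :=
  (BTree.isIncreasingComb_of_edges a.2.1 h).eq_leftComb a.2.2

/-- For the converse, some minimal tree lies below the comb, and minimal trees are combs, so the
comb itself is minimal. -/
theorem mem_pbwBasisOf_iff {a : ShTree n} :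
    a ∈ pbwBasisOf bjornerGessel n ↔ a.1 = BTree.leftComb n := by
  have key : ∀ {a : ShTree n}, a ∈ pbwBasisOf bjornerGessel n → a.1 = BTree.leftComb n :=
    fun ha => eq_leftComb_of_edges fun _ => edgeRestriction_of_mem_pbwBasisOf ha
  refine ⟨key, fun h => ?_⟩
  obtain ⟨b, hb, -⟩ := exists_mem_pbwBasisOf a
  rwa [Subtype.ext (h.trans (key hb).symm)]

theorem mem_pbwBasisOf_iff_edges {a : ShTree n} : a ∈ pbwBasisOf bjornerGessel n ↔
    ∀ s, BTree.EdgeRestriction a.1 s → ∃ s' ∈ pbwBasisOf bjornerGessel 3, s'.1 = s := by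
  constructor
  · intro h s hs
    exact ⟨ShTree.tree12_3, mem_pbwBasisOf_iff.2 rfl, (edgeRestriction_of_mem_pbwBasisOf h hs).symm⟩
  · intro h
    refine mem_pbwBasisOf_iff.2 (eq_leftComb_of_edges fun s hs => ?_)
    obtain ⟨s', hs', rfl⟩ := h s hs
    exact mem_pbwBasisOf_iff.1 hs'

theorem exists_shTree_eq_leftComb (hn : 1 ≤ n) :
    ∃ a ∈ pbwBasisOf bjornerGessel n, a.1 = BTree.leftComb n :=
  ⟨⟨BTree.leftComb n, (BTree.leftComb_isShuffle n hn).1, by rw [BTree.leftComb_leaves n hn]⟩,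
    mem_pbwBasisOf_iff.2 rfl, rfl⟩

/-! ### The tree of the increasing chain -/

/-- Loop invariant: the remaining minima are 1 and m + 1, …, n, the comb on m leaves sits at 1, and
the other trees are still leaves. -/
theorem mergeTrees_leftComb {m : ℕ} {M : Finset ℕ} {ps : List (ℕ × ℕ)} {T : ℕ → BTree}
    (hm : 1 ≤ m) (hmn : m ≤ n) (h : IsMergeSeq M ps)
    (hM : ∀ i, i ∈ M ↔ i = 1 ∨ m < i ∧ i ≤ n) (hT1 : T 1 = BTree.leftComb m)
    (hT : ∀ i, m < i → T i = .leaf i) (hinc : (ps.map Prod.snd).Pairwise (· < ·))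
    (hend : M \ (ps.map Prod.snd).toFinset ⊆ {1}) : mergeTrees T ps 1 = BTree.leftComb n := by
  induction ps generalizing m M T with
  | nil =>
    have : m = n := by
      by_contra hne
      have h1 := hend (show n ∈ M \ _ by simp [hM]; omega)
      have := Finset.mem_singleton.1 h1
      omega
    subst this
    exact hT1
  | cons p ps ih =>
    obtain ⟨i, j⟩ := p
    obtain ⟨h1, h2, h3, h4⟩ := h
    simp only [List.map_cons, List.pairwise_cons] at hinc
    simp only at h1 h2 h3 h4
    rw [hM] at h1 h2
    -- Labels increase, so m + 1 would never be deleted if it were not deleted now. Its partner is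
    -- then a smaller remaining minimum, which can only be 1.
    have hj : j = m + 1 := by
      by_contra hne
      have h5 : m + 1 ∈ M \ (((i, j) :: ps).map Prod.snd).toFinset := by
        simp only [Finset.mem_sdiff, hM, List.mem_toFinset, List.map_cons, List.mem_cons, not_or]
        refine ⟨by omega, fun h => hne h.symm, fun h5 => ?_⟩
        have := hinc.1 _ h5
        omega
      have := Finset.mem_singleton.1 (hend h5)
      omega
    have hi : i = 1 := by omega
    subst hi hj
    rw [mergeTrees_cons]
    refine ih (m := m + 1) (by omega) (by omega) h4 (fun i => ?_) ?_ (fun i hi => ?_) hinc.2 ?_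
    · rw [Finset.mem_erase, hM]; omega
    · obtain ⟨k, rfl⟩ := Nat.exists_eq_add_of_le' hm
      simp only [Function.update_self]
      rw [hT1, hT _ (by omega)]
      rfl
    · rw [Function.update_of_ne (by omega), hT _ (by omega)]
    · intro i hi
      apply hend
      simp at hi ⊢
      tauto

theorem forgetLevels_eq_leftComb (hn : 1 ≤ n) {c : List (PartitionPoset n)}
    (h : IsMinIncreasingChain (bjornerGessel n) ⊥ ⊤ c) : forgetLevels c = BTree.leftComb n := by
  obtain ⟨ps, h1, h2, rfl⟩ := isMaxChainOf_iff.1 h.isMaxChain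
  have hinc := h.isIncreasing
  rw [IsIncreasing, chainLabels_mergeChain h1, List.isChain_iff_pairwise] at hinc
  rw [forgetLevels, buildTrees_mergeChain _ h1]
  refine mergeTrees_leftComb le_rfl hn h1 (fun i => ?_) rfl (fun _ _ => rfl) hinc ?_
  · rw [mins_bot, Finset.mem_Icc]; omega
  · rw [← mins_mergeEnd h1, h2]; exact mins_top

theorem mem_pbwBasisOf_iff_forgetLevels (a : ShTree n) : a ∈ pbwBasisOf bjornerGessel n ↔
    ∃ c : List (PartitionPoset n),
      IsMinIncreasingChain (bjornerGessel n) ⊥ ⊤ c ∧ forgetLevels c = a.1 := by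
  have hn : 1 ≤ n := by
    have := (a.mem_leaves _).1 a.1.minLeaf_mem
    exact this.1.trans this.2
  rw [mem_pbwBasisOf_iff]
  constructor
  · intro h
    obtain ⟨c, hc⟩ := exists_isMinIncreasingChain (bot_le : (⊥ : PartitionPoset n) ≤ ⊤)
    exact ⟨c, hc, by rw [forgetLevels_eq_leftComb hn hc, h]⟩
  · rintro ⟨c, hc, h⟩
    rw [← h, forgetLevels_eq_leftComb hn hc]

end PartitionPoset

/-! ## The quotient operad -/

/-! ### Equality in the quotient for trees with arbitrary leaf labels -/

section Congruence

variable {k : Type*} [CommRing k] {R : ∀ n, Set (ShTree n →₀ k)}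

/-- Here ρ is the rank in U and θ its inverse; they pass between arbitrary label sets and initial
intervals. -/
theorem exists_rank (U : Finset ℕ) : ∃ ρ θ : ℕ → ℕ, StrictMonoOn ρ U ∧
    ρ '' U = Set.Icc 1 U.card ∧ StrictMonoOn θ (Set.Icc 1 U.card) ∧ ∀ u ∈ U, θ (ρ u) = u := by
  set ρ : ℕ → ℕ := fun u => (U.filter (· ≤ u)).card with hρ
  have hmono : StrictMonoOn ρ U := by
    intro u _ v hv huv
    refine Finset.card_lt_card (Finset.ssubset_iff_of_subset
      (Finset.monotone_filter_right _ fun _ _ h => le_trans h huv.le) |>.2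
      ⟨v, Finset.mem_filter.2 ⟨hv, le_rfl⟩, fun h => ?_⟩)
    exact huv.not_ge (Finset.mem_filter.1 h).2
  have himage : ρ '' U = Set.Icc 1 U.card := by
    have h1 : U.image ρ = Finset.Icc 1 U.card := by
      refine Finset.eq_of_subset_of_card_le (fun v hv => ?_) ?_
      · obtain ⟨u, hu, rfl⟩ := Finset.mem_image.1 hv
        exact Finset.mem_Icc.2 ⟨Finset.card_pos.2 ⟨u, Finset.mem_filter.2 ⟨hu, le_rfl⟩⟩,
          Finset.card_le_card (Finset.filter_subset _ _)⟩
      · rw [Finset.card_image_of_injOn hmono.injOn, Nat.card_Icc, Nat.add_sub_cancel]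
    rw [← Finset.coe_image, h1, Finset.coe_Icc]
  have hinv : ∀ u ∈ U, Function.invFunOn ρ U (ρ u) = u := fun u hu =>
    hmono.injOn (Function.invFunOn_mem ⟨u, hu, rfl⟩) hu (Function.invFunOn_eq ⟨u, hu, rfl⟩)
  refine ⟨ρ, Function.invFunOn ρ U, hmono, himage, ?_, hinv⟩
  rw [← himage]
  rintro _ ⟨u, hu, rfl⟩ _ ⟨v, hv, rfl⟩ huv
  rw [hinv u hu, hinv v hv]
  exact (hmono.lt_iff_lt hu hv).1 huv

namespace BTree

/-- Graft the tree `B` on the leaves of `A` that are labelled by `j`. -/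
def subst (j : ℕ) (B A : BTree) : BTree := A.bind fun c => if c = j then B else leaf c

theorem subst_eq_self {j : ℕ} {A : BTree} (B : BTree) (h : j ∉ A.leaves) : subst j B A = A := by
  rw [subst, bind_congr (τ := leaf), bind_leaf]
  intro i hi
  have : i ≠ j := by
    rintro rfl
    exact h hi
  exact if_neg this

theorem subst_node (j : ℕ) (B l r : BTree) :
    subst j B (node l r) = node (subst j B l) (subst j B r) := rfl

theorem subst_leaf_self (j : ℕ) (B : BTree) : subst j B (leaf j) = B := if_pos rfl

theorem exists_eq_map {t : BTree} (h : t.IsShuffle) (hn : t.leaves.Nodup) :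
    ∃ (n : ℕ) (φ : ℕ → ℕ) (a : ShTree n), StrictMonoOn φ (Set.Icc 1 n) ∧ a.1.map φ = t := by
  obtain ⟨ρ, θ, hρ, himage, hθ, hinv⟩ := exists_rank t.leaves.toFinset
  have hmem : ∀ i ∈ t.leaves, i ∈ (t.leaves.toFinset : Set ℕ) := fun i hi => by simpa using hi
  refine ⟨_, θ, ⟨t.map ρ, isShuffle_bind (σ := fun i => leaf (ρ i)) hρ (fun _ _ => rfl)
    (fun _ _ => trivial) t hmem h, ?_⟩,
    hθ, ?_⟩
  · rw [leaves_map, List.perm_ext_iff_of_nodup ((List.nodup_map_iff_inj_on hn).2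
      fun x hx y hy h => hρ.injOn (hmem x hx) (hmem y hy) h) List.nodup_range']
    intro i
    have := Set.ext_iff.1 himage i
    simp only [Set.mem_image, Finset.mem_coe, List.mem_toFinset, Set.mem_Icc] at this
    rw [List.mem_map, this, List.mem_range'_1]
    omega
  · change ((t.bind _).bind _) = t
    rw [bind_bind, bind_congr (τ := leaf), bind_leaf]
    intro i hi
    exact congrArg leaf (hinv i (by simpa using hi))

end BTree

theorem ShTree.minLeaf_eq_one {n : ℕ} (a : ShTree n) : a.1.minLeaf = 1 := by
  have h := (a.mem_leaves _).1 a.1.minLeaf_mem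
  exact le_antisymm (a.1.minLeaf_le ((a.mem_leaves 1).2 ⟨le_rfl, h.1.trans h.2⟩)) h.1

theorem ShTree.one_le {n : ℕ} (a : ShTree n) : 1 ≤ n := by
  have h := (a.mem_leaves _).1 a.1.minLeaf_mem
  exact h.1.trans h.2

/-- Grafting trees whose label sets meet in a single point is a shuffle composition after passing to
ranks in the union. The shuffle depends only on the label sets, so one `w` serves all pairs of trees
and can be applied to differences. -/
theorem exists_pointedShuffle {m n i : ℕ} {φ ψ : ℕ → ℕ} (hi : i ∈ Set.Icc 1 m) (hn : 1 ≤ n)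
    (hφ : StrictMonoOn φ (Set.Icc 1 m)) (hψ : StrictMonoOn ψ (Set.Icc 1 n)) (hij : ψ 1 = φ i)
    (hd : ∀ a ∈ Set.Icc 1 m, ∀ b ∈ Set.Icc 1 n, φ a = ψ b → a = i) :
    ∃ (p : ℕ) (w : PointedShuffle m n p) (θ : ℕ → ℕ), StrictMonoOn θ (Set.Icc 1 p) ∧
      ∀ (α : ShTree m) (β : ShTree n),
        (ShTree.comp w α β).1.map θ = BTree.subst (φ i) (β.1.map ψ) (α.1.map φ) := by
  obtain ⟨ρ, θ, hρ, himage, hθ, hinv⟩ :=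
    exists_rank ((Finset.Icc 1 m).image φ ∪ (Finset.Icc 1 n).image ψ)
  set U := (Finset.Icc 1 m).image φ ∪ (Finset.Icc 1 n).image ψ with hU
  have hφU : ∀ a ∈ Set.Icc 1 m, φ a ∈ U := fun a ha =>
    Finset.mem_union_left _ (Finset.mem_image_of_mem _ (Finset.mem_Icc.2 ha))
  have hψU : ∀ b ∈ Set.Icc 1 n, ψ b ∈ U := fun b hb =>
    Finset.mem_union_right _ (Finset.mem_image_of_mem _ (Finset.mem_Icc.2 hb))
  have h1n : (1 : ℕ) ∈ Set.Icc 1 n := ⟨le_rfl, hn⟩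
  refine ⟨U.card,
    { i := i
      f := ρ ∘ φ
      g := ρ ∘ ψ
      i_mem := hi
      f_strictMono := fun a ha b hb h => hρ (hφU a ha) (hφU b hb) (hφ ha hb h)
      g_strictMono := fun a ha b hb h => hρ (hψU a ha) (hψU b hb) (hψ ha hb h)
      pointed := congrArg ρ hij
      disjoint := ?_
      cover := ?_ }, θ, hθ, fun α β => ?_⟩
  · rw [Set.disjoint_left]
    rintro _ ⟨a, ⟨ha, hai⟩, rfl⟩ ⟨b, hb, h⟩
    exact hai (hd a ha b hb (hρ.injOn (hφU a ha) (hψU b hb) h.symm))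
  · rw [← himage]
    ext v
    constructor
    · rintro (⟨a, ⟨ha, -⟩, rfl⟩ | ⟨b, hb, rfl⟩)
      · exact ⟨_, hφU a ha, rfl⟩
      · exact ⟨_, hψU b hb, rfl⟩
    · rintro ⟨u, hu, rfl⟩
      rcases Finset.mem_union.1 hu with hu | hu
      · obtain ⟨a, ha, rfl⟩ := Finset.mem_image.1 hu
        by_cases hai : a = i
        · exact Or.inr ⟨1, h1n, by rw [hai, ← hij]; rfl⟩
        · exact Or.inl ⟨a, ⟨Finset.mem_Icc.1 ha, hai⟩, rfl⟩
      · obtain ⟨b, hb, rfl⟩ := Finset.mem_image.1 hu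
        exact Or.inr ⟨b, Finset.mem_Icc.1 hb, rfl⟩
  · rw [ShTree.comp, BTree.map, BTree.bind_bind, BTree.subst, BTree.map.eq_def φ, BTree.bind_bind]
    refine BTree.bind_congr fun a ha => ?_
    have ha' := (α.mem_leaves a).1 ha
    simp only [ShTree.graftAt, BTree.bind]
    by_cases hai : a = i
    · rw [if_pos hai, if_pos (by rw [hai]), BTree.map, BTree.bind_bind, BTree.map]
      exact BTree.bind_congr fun b hb =>
        congrArg BTree.leaf (hinv _ (hψU b ((β.mem_leaves b).1 hb)))
    · rw [if_neg hai, if_neg fun h => hai (hφ.injOn ha' hi h)]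
      exact congrArg BTree.leaf (hinv _ (hφU a ha'))

/-- Two trees with the same set of leaves, which need not be of the form `{1, …, n}`, have the same
class in the quotient operad. -/
def TreeCongr (R : ∀ n, Set (ShTree n →₀ k)) (A A' : BTree) : Prop :=
  ∃ (n : ℕ) (φ : ℕ → ℕ) (a a' : ShTree n), StrictMonoOn φ (Set.Icc 1 n) ∧ a.1.map φ = A ∧
    a'.1.map φ = A' ∧ Finsupp.single a 1 - Finsupp.single a' 1 ∈ shuffleIdeal R n

theorem ShTree.mem_leaves_map {n : ℕ} (a : ShTree n) (φ : ℕ → ℕ) (j : ℕ) :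
    j ∈ (a.1.map φ).leaves ↔ ∃ i ∈ Set.Icc 1 n, φ i = j := by
  rw [BTree.leaves_map, List.mem_map]
  simp only [a.mem_leaves]

theorem ShTree.minLeaf_map {n : ℕ} (a : ShTree n) {φ : ℕ → ℕ}
    (hφ : StrictMonoOn φ (Set.Icc 1 n)) : (a.1.map φ).minLeaf = φ 1 := by
  rw [BTree.map, BTree.minLeaf_bind hφ (fun _ _ => rfl) _ fun i => (a.mem_leaves i).1,
    a.minLeaf_eq_one]

theorem exists_pointedShuffle_subst {m n : ℕ} {φ ψ : ℕ → ℕ} (α : ShTree m) (β : ShTree n)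
    (hφ : StrictMonoOn φ (Set.Icc 1 m)) (hψ : StrictMonoOn ψ (Set.Icc 1 n))
    (hj : (β.1.map ψ).minLeaf ∈ (α.1.map φ).leaves)
    (hd : ∀ c ∈ (α.1.map φ).leaves, c ∈ (β.1.map ψ).leaves → c = (β.1.map ψ).minLeaf) :
    ∃ (p : ℕ) (w : PointedShuffle m n p) (θ : ℕ → ℕ), StrictMonoOn θ (Set.Icc 1 p) ∧
      ∀ (α' : ShTree m) (β' : ShTree n), (ShTree.comp w α' β').1.map θ =
        BTree.subst (β.1.map ψ).minLeaf (β'.1.map ψ) (α'.1.map φ) := by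
  obtain ⟨i, hi, hij⟩ := (α.mem_leaves_map φ _).1 hj
  rw [← hij]
  rw [β.minLeaf_map hψ] at hij
  refine exists_pointedShuffle hi β.one_le hφ hψ hij.symm fun a ha b hb hab => ?_
  have := hd (φ a) ((α.mem_leaves_map φ _).2 ⟨a, ha, rfl⟩)
    ((β.mem_leaves_map ψ _).2 ⟨b, hb, hab.symm⟩)
  rw [β.minLeaf_map hψ, ← hij] at this
  exact hφ.injOn ha hi this

theorem TreeCongr.subst_left {A A' B : BTree} (h : TreeCongr R A A') (hB : B.IsShuffle)
    (hn : B.leaves.Nodup) (hj : B.minLeaf ∈ A.leaves)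
    (hd : ∀ c ∈ A.leaves, c ∈ B.leaves → c = B.minLeaf) :
    TreeCongr R (BTree.subst B.minLeaf B A) (BTree.subst B.minLeaf B A') := by
  obtain ⟨m, φ, α, α', hφ, rfl, rfl, hmem⟩ := h
  obtain ⟨n, ψ, β, hψ, rfl⟩ := BTree.exists_eq_map hB hn
  obtain ⟨p, w, θ, hθ, hw⟩ := exists_pointedShuffle_subst α β hφ hψ hj hd
  refine ⟨p, θ, _, _, hθ, hw α β, hw α' β, ?_⟩
  have := MemShuffleIdeal.compLeft w β hmem
  rwa [sub_eq_add_neg, ← Finsupp.single_neg, Finsupp.mapDomain_add, Finsupp.mapDomain_single,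
    Finsupp.mapDomain_single, Finsupp.single_neg, ← sub_eq_add_neg] at this

theorem TreeCongr.subst_right {A B B' : BTree} (h : TreeCongr R B B') (hA : A.IsShuffle)
    (hn : A.leaves.Nodup) (hj : B.minLeaf ∈ A.leaves)
    (hd : ∀ c ∈ A.leaves, c ∈ B.leaves → c = B.minLeaf) :
    TreeCongr R (BTree.subst B.minLeaf B A) (BTree.subst B.minLeaf B' A) := by
  obtain ⟨n, ψ, β, β', hψ, rfl, rfl, hmem⟩ := h
  obtain ⟨m, φ, α, hφ, rfl⟩ := BTree.exists_eq_map hA hn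
  obtain ⟨p, w, θ, hθ, hw⟩ := exists_pointedShuffle_subst α β hφ hψ hj hd
  refine ⟨p, θ, _, _, hθ, hw α β, hw α β', ?_⟩
  have := MemShuffleIdeal.compRight w α hmem
  rwa [sub_eq_add_neg, ← Finsupp.single_neg, Finsupp.mapDomain_add, Finsupp.mapDomain_single,
    Finsupp.mapDomain_single, Finsupp.single_neg, ← sub_eq_add_neg] at this

/-- A strictly increasing relabelling of 1, …, n by itself is the identity, so the witnesses of the
congruence are the two given trees. -/
theorem TreeCongr.treeClass_eq {n : ℕ} {a a' : ShTree n} (h : TreeCongr R a.1 a'.1) :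
    treeClass R a = treeClass R a' := by
  obtain ⟨m, φ, b, b', hφ, h1, h2, hmem⟩ := h
  have h3 : (b.1.leaves.map φ).Perm (List.range' 1 n) := by
    rw [← BTree.leaves_map, h1]; exact a.2.2
  have h4 := (b.2.2.map φ).symm.trans h3
  obtain rfl : m = n := by simpa using h4.length_eq
  have h5 : (List.range' 1 m).map φ = List.range' 1 m := by
    refine h4.eq_of_pairwise (fun _ _ _ _ h h' => absurd h h'.not_gt) ?_ List.pairwise_lt_range'
    refine List.pairwise_map.2 (List.Pairwise.imp_of_mem (fun hx hy h => hφ ?_ ?_ h)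
      List.pairwise_lt_range')
    · rw [List.mem_range'_1] at hx; exact ⟨hx.1, by omega⟩
    · rw [List.mem_range'_1] at hy; exact ⟨hy.1, by omega⟩
  have h6 : ∀ i ∈ List.range' 1 m, φ i = id i := List.map_inj_left.1 (by rw [h5, List.map_id])
  have h7 : ∀ c : ShTree m, c.1.map φ = c.1 := by
    intro c
    rw [BTree.map, BTree.bind_congr (τ := .leaf), BTree.bind_leaf]
    exact fun i hi => congrArg BTree.leaf (h6 i (c.2.2.mem_iff.1 hi))
  rw [h7] at h1 h2
  obtain rfl := Subtype.ext h1
  obtain rfl := Subtype.ext h2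
  rw [treeClass, treeClass, ← sub_eq_zero, ← map_sub]
  exact (Submodule.Quotient.mk_eq_zero _).2 hmem

end Congruence

/-! ### Rewriting moves follow from the relations of Com -/

namespace BTree

variable {k : Type*} [CommRing k] {R : ∀ n, Set (ShTree n →₀ k)}

/-- The tree `node l r` is a two-leaf corolla, labelled by the two minima, with l and then r grafted
on it; the first grafting carries the congruence. -/
theorem treeCongr_node_left {l l' r : BTree} (h : TreeCongr R l l')
    (hp : l.leaves.Perm l'.leaves) (hs : (node l r).IsShuffle) (hn : (node l r).leaves.Nodup) :
    TreeCongr R (node l r) (node l' r) := by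
  obtain ⟨h1, h2, h3⟩ := List.nodup_append'.1 hn
  have hr := r.minLeaf_mem
  have hrl : r.minLeaf ∉ l.leaves := fun h => h3 h hr
  have hrl' : r.minLeaf ∉ l'.leaves := fun h => hrl (hp.mem_iff.2 h)
  have key := h.subst_right (A := node (leaf l.minLeaf) (leaf r.minLeaf))
    ⟨hs.1, trivial, trivial⟩ (by simpa [leaves] using hs.1.ne) (by simp [leaves]) (by
      simp only [leaves, List.mem_append, List.mem_singleton]
      rintro c (rfl | rfl) hc
      · rfl
      · exact absurd hc hrl)
  have hne : l.minLeaf ∉ (leaf r.minLeaf).leaves := by simpa [leaves] using hs.1.ne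
  rw [subst_node, subst_node, subst_leaf_self, subst_leaf_self, subst_eq_self _ hne,
    subst_eq_self _ hne] at key
  have key2 := key.subst_left hs.2.2 h2 (by simp [leaves]) (by
      simp only [leaves, List.mem_append, List.mem_singleton]
      rintro c (hc | rfl) hc'
      · exact absurd hc' fun h => h3 hc h
      · rfl)
  rwa [subst_node, subst_node, subst_leaf_self, subst_eq_self _ hrl, subst_eq_self _ hrl'] at key2

theorem treeCongr_node_right {l r r' : BTree} (h : TreeCongr R r r')
    (hs : (node l r).IsShuffle) (hn : (node l r).leaves.Nodup) :
    TreeCongr R (node l r) (node l r') := by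
  obtain ⟨h1, h2, h3⟩ := List.nodup_append'.1 hn
  have hr := r.minLeaf_mem
  have hrl : r.minLeaf ∉ l.leaves := fun h => h3 h hr
  have key := h.subst_right (A := node l (leaf r.minLeaf))
    ⟨hs.1, hs.2.1, trivial⟩ (by
      simpa [leaves, List.nodup_append'] using ⟨h1, hrl⟩) (by simp [leaves]) (by
      simp only [leaves, List.mem_append, List.mem_singleton]
      rintro c (hc | rfl) hc'
      · exact absurd hc' fun h => h3 hc h
      · rfl)
  rwa [subst_node, subst_node, subst_leaf_self, subst_leaf_self, subst_eq_self _ hrl,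
    subst_eq_self _ hrl] at key

theorem treeCongr_leaves {a b c : ℕ} (hab : a < b) (hbc : b < c) {s : BTree}
    (hs : s = node (node (leaf a) (leaf c)) (leaf b) ∨
      s = node (leaf a) (node (leaf b) (leaf c))) :
    TreeCongr (comRelations k) (node (node (leaf a) (leaf b)) (leaf c)) s := by
  have hφ : StrictMonoOn (fun i => if i = 1 then a else if i = 2 then b else c)
      (Set.Icc 1 3) := by
    rintro i ⟨hi, hi'⟩ j ⟨hj, hj'⟩ hij
    interval_cases i <;> interval_cases j <;> simp at hij ⊢ <;> omega
  have r1 : Finsupp.single ShTree.tree1_23 (1 : k) - Finsupp.single ShTree.tree12_3 1 ∈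
      shuffleIdeal (comRelations k) 3 := MemShuffleIdeal.rel (by simp [comRelations])
  have r2 : Finsupp.single ShTree.tree1_23 (1 : k) - Finsupp.single ShTree.tree13_2 1 ∈
      shuffleIdeal (comRelations k) 3 := MemShuffleIdeal.rel (by simp [comRelations])
  rcases hs with rfl | rfl
  · refine ⟨3, _, ShTree.tree12_3, ShTree.tree13_2, hφ, rfl, rfl, ?_⟩
    have := sub_mem r2 r1
    rwa [sub_sub_sub_cancel_left] at this
  · refine ⟨3, _, ShTree.tree12_3, ShTree.tree1_23, hφ, rfl, rfl, ?_⟩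
    have := neg_mem r1
    rwa [neg_sub] at this

/-- The three-leaf relation on min A, min B, min C, with A, B and C grafted in turn. Disjointness
ensures that each grafting affects only its own leaf. -/
theorem treeCongr_root {A B C t : BTree} (hs : (node (node A B) C).IsShuffle)
    (hn : (node (node A B) C).leaves.Nodup) (hBC : B.minLeaf < C.minLeaf)
    (ht : t = node (node A C) B ∨ t = node A (node B C)) :
    TreeCongr (comRelations k) (node (node A B) C) t := by
  obtain ⟨h1, hC, h3⟩ := List.nodup_append'.1 hn
  obtain ⟨hA, hB, hAB⟩ := List.nodup_append'.1 h1
  have hAC : A.leaves.Disjoint C.leaves := fun i hi => h3 (List.mem_append_left _ hi)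
  have hBC' : B.leaves.Disjoint C.leaves := fun i hi => h3 (List.mem_append_right _ hi)
  have ha := A.minLeaf_mem
  have hb := B.minLeaf_mem
  have hc := C.minLeaf_mem
  have hlt : A.minLeaf < B.minLeaf := hs.2.1.1
  have hbA : B.minLeaf ∉ A.leaves := fun h => hAB h hb
  have hcA : C.minLeaf ∉ A.leaves := fun h => hAC h hc
  have hcB : C.minLeaf ∉ B.leaves := fun h => hBC' h hc
  have haB : A.minLeaf ∉ B.leaves := fun h => hAB ha h
  have hbC : B.minLeaf ∉ C.leaves := fun h => hBC' hb h
  have hleaf : ∀ {i j : ℕ}, i ≠ j → i ∉ (leaf j).leaves := fun h => by simpa [leaves] using h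
  have hac := hlt.trans hBC
  have key : ∀ s, (s = node (node (leaf A.minLeaf) (leaf C.minLeaf)) (leaf B.minLeaf) ∨
      s = node (leaf A.minLeaf) (node (leaf B.minLeaf) (leaf C.minLeaf))) →
      TreeCongr (comRelations k) (node (node A B) C)
        (subst C.minLeaf C (subst B.minLeaf B (subst A.minLeaf A s))) := by
    intro s hs'
    have e1 := (treeCongr_leaves (k := k) hlt hBC hs').subst_left hs.2.1.2.1 hA
      (by simp [leaves]) (by
        simp only [leaves, List.mem_append, List.mem_singleton]
        rintro i ((rfl | rfl) | rfl) hi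
        · rfl
        · exact absurd hi hbA
        · exact absurd hi hcA)
    rw [subst_node, subst_node, subst_leaf_self, subst_eq_self _ (hleaf hlt.ne),
      subst_eq_self _ (hleaf hac.ne)] at e1
    have e2 := e1.subst_left hs.2.1.2.2 hB (by simp [leaves]) (by
        simp only [leaves, List.mem_append, List.mem_singleton]
        rintro i ((hi' | rfl) | rfl) hi
        · exact absurd hi fun h => hAB hi' h
        · rfl
        · exact absurd hi hcB)
    rw [subst_node, subst_node, subst_leaf_self, subst_eq_self _ hbA,
      subst_eq_self _ (hleaf hBC.ne)] at e2
    have e3 := e2.subst_left hs.2.2 hC (by simp [leaves]) (by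
        simp only [leaves, List.mem_append, List.mem_singleton]
        rintro i ((hi' | hi') | rfl) hi
        · exact absurd hi fun h => hAC hi' h
        · exact absurd hi fun h => hBC' hi' h
        · rfl)
    rwa [subst_node, subst_node, subst_leaf_self, subst_eq_self _ hcA, subst_eq_self _ hcB] at e3
  rcases ht with rfl | rfl
  · have := key _ (Or.inl rfl)
    simpa only [subst_node, subst_leaf_self, subst_eq_self _ (hleaf hlt.ne),
      subst_eq_self _ (hleaf hac.ne), subst_eq_self _ hbA, subst_eq_self _ (hleaf hBC.ne),
      subst_eq_self _ hcA, subst_eq_self _ hcB] using this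
  · have := key _ (Or.inr rfl)
    simpa only [subst_node, subst_leaf_self, subst_eq_self _ (hleaf hlt.ne),
      subst_eq_self _ (hleaf hac.ne), subst_eq_self _ hbA, subst_eq_self _ (hleaf hBC.ne),
      subst_eq_self _ hcA, subst_eq_self _ hcB] using this

theorem Step.treeCongr {a b : BTree} (h : Step a b) (ha : a.IsShuffle) (hn : a.leaves.Nodup) :
    TreeCongr (comRelations k) a b := by
  induction h with
  | swap A B C _ h2 => exact treeCongr_root ha hn h2 (Or.inl rfl)
  | rot A B C _ h2 => exact treeCongr_root ha hn h2 (Or.inr rfl)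
  | inLeft r h ih =>
    exact treeCongr_node_left (ih ha.2.1 (List.nodup_append'.1 hn).1) h.leaves_perm ha hn
  | inRight l h ih =>
    exact treeCongr_node_right (ih ha.2.2 (List.nodup_append'.1 hn).2.1) ha hn

end BTree

open PartitionPoset

/-! ### The sum of coefficients and the PBW basis -/

section Com

variable {k : Type*} [CommRing k] {n : ℕ}

theorem treeClass_eq_of_treeLE {a b : ShTree n} (h : TreeLE bjornerGessel n a b) :
    treeClass (comRelations k) a = treeClass (comRelations k) b := by
  rw [treeLE_iff] at h
  obtain ⟨b, hb⟩ := b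
  change Relation.ReflTransGen BTree.Step a.1 b at h
  induction h with
  | refl => rfl
  | @tail t b h1 h2 ih =>
    obtain ⟨c, rfl⟩ := exists_shTree_of_step (b := ⟨b, hb⟩) h2
    rw [ih c.2]
    exact (h2.treeCongr c.2.1 (c.2.2.nodup_iff.2 List.nodup_range')).treeClass_eq

/-- The sum of the coefficients. -/
noncomputable def coeffSum (k : Type*) [CommRing k] (n : ℕ) : (ShTree n →₀ k) →ₗ[k] k :=
  Finsupp.linearCombination k fun _ => 1

theorem coeffSum_single (a : ShTree n) (c : k) : coeffSum k n (Finsupp.single a c) = c := by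
  simp [coeffSum]

/-- The relations are differences of two trees, and composing with a tree maps trees to trees, which
preserves the sum of the coefficients. -/
theorem coeffSum_eq_zero {x : ShTree n →₀ k} (h : x ∈ shuffleIdeal (comRelations k) n) :
    coeffSum k n x = 0 := by
  change MemShuffleIdeal (comRelations k) n x at h
  induction h with
  | @rel n x h =>
    unfold comRelations at h
    split at h
    · rcases h with rfl | rfl <;> rw [map_sub, coeffSum_single, coeffSum_single, sub_self]
    · exact h.elim
  | zero n => exact map_zero _
  | add _ _ h h' => rw [map_add, h, h', add_zero]
  | smul c _ h => rw [map_smul, h, smul_zero]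
  | compRight w α _ h => rwa [coeffSum, Finsupp.linearCombination_mapDomain]
  | compLeft w β _ h => rwa [coeffSum, Finsupp.linearCombination_mapDomain]

instance : Subsingleton (pbwBasisOf bjornerGessel n) :=
  ⟨fun a b => Subtype.ext (Subtype.ext
    ((mem_pbwBasisOf_iff.1 a.2).trans (mem_pbwBasisOf_iff.1 b.2).symm))⟩

theorem isPBWBasis_pbwBasisOf :
    IsPBWBasis (comRelations k) (TreeLE bjornerGessel) (pbwBasisOf bjornerGessel) where
  le_refl _ _ := .refl
  le_trans _ _ _ _ h h' := h.trans h'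
  le_antisymm _ _ _ h h' := treeLE_antisymm h h'
  le_comp _ _ _ w _ _ _ _ h h' := treeLE_comp w h h'
  unit_mem := mem_pbwBasisOf_iff.2 rfl
  gen_mem := mem_pbwBasisOf_iff.2 rfl
  linearIndependent n := by
    rw [linearIndependent_iff']
    intro s g hg b hb
    have hs : s = {b} := Finset.eq_singleton_iff_unique_mem.2
      ⟨hb, fun c _ => Subsingleton.elim _ _⟩
    rw [hs, Finset.sum_singleton, treeClass, ← map_smul, Submodule.mkQ_apply,
      Submodule.Quotient.mk_eq_zero] at hg
    -- The family has at most one member, so a linear relation is a multiple of one tree in the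
    -- ideal, and its coefficient sum is the multiplier.
    simpa [coeffSum_single] using coeffSum_eq_zero hg
  span_eq_top n := by
    refine eq_top_iff.2 fun q _ => ?_
    obtain ⟨f, rfl⟩ := Submodule.mkQ_surjective _ q
    induction f using Finsupp.induction_linear with
    | zero => rw [map_zero]; exact zero_mem _
    | add f g hf hg => rw [map_add]; exact add_mem (hf trivial) (hg trivial)
    | single a c =>
      obtain ⟨b, hb, hba⟩ := exists_mem_pbwBasisOf a
      have h1 : (shuffleIdeal (comRelations k) n).mkQ (Finsupp.single a c) =
          c • treeClass (comRelations k) b := by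
        rw [treeClass_eq_of_treeLE hba, treeClass, ← map_smul, Finsupp.smul_single, smul_eq_mul,
          mul_one]
      rw [h1]
      exact Submodule.smul_mem _ _ (Submodule.subset_span ⟨⟨b, hb⟩, rfl⟩)
  comp_mem_or m n p w α _ β _ := by
    obtain ⟨b, hb, hba⟩ := exists_mem_pbwBasisOf (ShTree.comp w α β)
    by_cases h : b = ShTree.comp w α β
    · exact Or.inl (h ▸ hb)
    · refine Or.inr ⟨Finsupp.single b 1, fun γ hγ => ?_, ?_⟩
      · obtain rfl := Finset.mem_singleton.1 (Finsupp.support_single_subset hγ)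
        exact ⟨hb, hba, h⟩
      · rw [Finsupp.sum_single_index (by exact zero_smul _ _), one_smul, treeClass_eq_of_treeLE hba]
  mem_iff_edges _ _ := mem_pbwBasisOf_iff_edges

end Com

theorem mainTheorem6 (k : Type*) [CommRing k] :
    (∀ n : ℕ, 1 ≤ n → IsELLabelling (bjornerGessel n)) ∧
    IsPBWBasis (comRelations k) (TreeLE bjornerGessel) (pbwBasisOf bjornerGessel) ∧
    (∀ (n : ℕ) (a : ShTree n), a ∈ pbwBasisOf bjornerGessel n ↔
      ∃ c : List (PartitionPoset n),
        IsMinIncreasingChain (bjornerGessel n) ⊥ ⊤ c ∧ forgetLevels c = a.1) ∧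
    (∀ n : ℕ, 1 ≤ n → Subtype.val '' pbwBasisOf bjornerGessel n = {BTree.leftComb n}) := by
  refine ⟨fun n _ => bjornerGessel_isELLabelling n, isPBWBasis_pbwBasisOf,
    fun n a => mem_pbwBasisOf_iff_forgetLevels a, fun n hn => ?_⟩
  obtain ⟨a, ha, h⟩ := exists_shTree_eq_leftComb hn
  refine Set.eq_singleton_iff_unique_mem.2 ⟨⟨a, ha, h⟩, ?_⟩
  rintro _ ⟨b, hb, rfl⟩
  exact mem_pbwBasisOf_iff.1 hb
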